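/- A \emph{distance space} is a set $X$ with a map $d\colon X\times X\to[0,\infty]$ such that $d(x,y)=0$ if and only if $x=y$, $d(x,y)=d(y,x)$ and $d(x,z)\le d(x,y)+d(y,z)$. It carries the topology generated by the open balls. A \emph{distance measure space} $(X,d,\mu)$ is a distance space $(X,d)$ with a finite regular Borel measure $\mu$. For $L>0$ and $\varepsilon\ge 0$, an \emph{$L$-isometric $\varepsilon$-embedding} of a distance measure space $(X,d,\mu)$ into a distance space $(Z,d_Z)$ is a Borel map $\iota\colon X\to Z$ for which there is a Borel set $E\subset X$ with $\mu(E)\le\varepsilon$ such that, for all $x,y\in X\setminus E$, $d_Z(\iota(x),\iota(y))=d(x,y)$ whenever $\min\{d_Z(\iota(x),\iota(y)),d(x,y)\}<L$. For finite Borel measures $\nu_1,\nu_2$ on $Z$ let $$d_\pi(\nu_1,\nu_2)=\inf\{\delta>0 : \nu_1(A)\le\nu_2(A^\delta)+\delta\text{ and }\nu_2(A)\le\nu_1(A^\delta)+\delta\text{ for all Borel }A\subset Z\},$$ where $A^\delta=\{z\in Z:\exists a\in A,\ d_Z(z,a)<\delta\}$. Define $$d_\rho(X_1,X_2)=\inf\Big\{d_\pi\big((\iota_1)_*\mu_1,(\iota_2)_*\mu_2\big)+\tfrac1L+\varepsilon\Big\},$$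 the infimum over all distance spaces $Z$, all $L>0$, $\varepsilon\ge0$ and all pairs of $L$-isometric $\varepsilon$-embeddings $\iota_i\colon X_i\to Z$, $i=1,2$. \textbf{Theorem.} On complete separable distance measure spaces, $X\sim Y$ if and only if $d_\rho(X,Y)=0$ is an equivalence relation, and the space $\mathfrak X$ of its equivalence classes is complete for $d_\rho$: every Cauchy sequence in $\mathfrak X$ converges. Explicitly, let $(\xi_n)_{n\in\mathbb N}$ be a sequence in $\mathfrak X$ such that for every $\epsilon>0$ there is an $N$ such that for all $m,n\ge N$ the classes $\xi_m,\xi_n$ have representatives $X,Y$ with $d_\rho(X,Y)<\epsilon$. Then there is a class $\xi\in\mathfrak X$ such that for every $\epsilon>0$ there is an $N$ such that $d_\rho(X,Y)<\epsilon$ for all $n\ge N$ and all representatives $X$ of $\xi_n$ and $Y$ of $\xi$. -/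

import Mathlib

open MeasureTheory Set
open scoped ENNReal NNReal

universe u

/-- A complete separable distance measure space: a set with a distance that may take the value
`∞` (an `EMetricSpace`), complete and separable, with a finite regular Borel measure. -/
structure DistMeasSpace : Type (u + 1) where
  carrier : Type u
  [emetric : EMetricSpace carrier]
  [complete : CompleteSpace carrier]
  [separable : TopologicalSpace.SeparableSpace carrier]
  [measurable : MeasurableSpace carrier]
  [borel : BorelSpace carrier]
  μ : Measure carrier
  [finite : IsFiniteMeasure μ]
  [regular : μ.Regular]

namespace DistMeasSpace

instance : CoeSort DistMeasSpace.{u} (Type u) := ⟨DistMeasSpace.carrier⟩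

attribute [instance] emetric complete separable measurable borel finite regular

end DistMeasSpace

/-- `f` restricted to `s` is an `L`-isometric embedding: it preserves the distance of any two
points as soon as the distance of the points or that of their images is less than `L`. -/
def IsLIsometricOn {M N : Type*} [EMetricSpace M] [EMetricSpace N] (L : ℝ) (f : M → N)
    (s : Set M) : Prop :=
  ∀ x ∈ s, ∀ y ∈ s, min (edist (f x) (f y)) (edist x y) < ENNReal.ofReal L →
    edist (f x) (f y) = edist x y

/-- `f` is an `L`-isometric `ε`-embedding of the distance measure space `X` into the distance
space `Z`: a Borel map, so that the push-forward of the measure of `X` is defined, which is an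
`L`-isometric embedding outside a set of measure at most `ε`. -/
def IsLIsometricEpsEmbedding (X : DistMeasSpace.{u}) {Z : Type u} [EMetricSpace Z]
    [MeasurableSpace Z] (L : ℝ) (ε : ℝ≥0) (f : X → Z) : Prop :=
  Measurable f ∧ ∃ E : Set X, MeasurableSet E ∧ X.μ E ≤ ε ∧ IsLIsometricOn L f Eᶜ

/-- The generalised Gromov-Hausdorff-Levy-Prokhorov distance `d_ρ`: the infimum of
`d_π((ι₁)_* μ₁, (ι₂)_* μ₂) + 1 / L + ε` over all `L > 0`, `ε ≥ 0` and all pairs of `L`-isometric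
`ε`-embeddings into a common distance space `Z` with its Borel `σ`-algebra, where `d_π` is the
Levy-Prokhorov distance. -/
noncomputable def dRho (X Y : DistMeasSpace.{u}) : ℝ≥0∞ :=
  sInf {r | ∃ (Z : Type u) (_ : EMetricSpace Z) (_ : MeasurableSpace Z) (_ : BorelSpace Z)
    (L : ℝ) (ε : ℝ≥0) (f : X → Z) (g : Y → Z), 0 < L ∧
    IsLIsometricEpsEmbedding X L ε f ∧ IsLIsometricEpsEmbedding Y L ε g ∧
    r = levyProkhorovEDist (X.μ.map f) (Y.μ.map g) + ENNReal.ofReal (1 / L) + ε}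

/-- The relation `X ∼ Y` if and only if `d_ρ(X, Y) = 0`. -/
def RhoEquiv (X Y : DistMeasSpace.{u}) : Prop := dRho X Y = 0

/-- The space `𝔛` of complete separable distance measure spaces modulo `∼`. -/
def DMSpace : Type (u + 1) := Quot RhoEquiv.{u}

/-- The class of a complete separable distance measure space in `𝔛`. -/
def DMSpace.mk (X : DistMeasSpace.{u}) : DMSpace.{u} := Quot.mk RhoEquiv X

/-- A sequence in `𝔛` is Cauchy for `d_ρ`. Each distance is only required to be small for some
choice of representatives of the two classes. -/
def DMSpace.IsCauchy (ξ : ℕ → DMSpace.{u}) : Prop :=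
  ∀ ε : ℝ≥0∞, 0 < ε → ∃ N : ℕ, ∀ m ≥ N, ∀ n ≥ N,
    ∃ X Y : DistMeasSpace.{u}, mk X = ξ m ∧ mk Y = ξ n ∧ dRho X Y < ε

/-- A sequence in `𝔛` converges to `η` for `d_ρ`. Each distance is required to be small for every
choice of representatives of the two classes. -/
def DMSpace.ConvergesTo (ξ : ℕ → DMSpace.{u}) (η : DMSpace.{u}) : Prop :=
  ∀ ε : ℝ≥0∞, 0 < ε → ∃ N : ℕ, ∀ n ≥ N,
    ∀ X Y : DistMeasSpace.{u}, mk X = ξ n → mk Y = η → dRho X Y < ε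

/-! Closeness is handled through the single parameter of `RhoClose`, comparable with `dRho` by
`RhoClose.dRho_le` and `RhoClose.of_dRho_lt`. It satisfies a triangle inequality up to the factor 4
(`RhoClose.trans`), because ambient spaces with truncated distances can be glued along the part of
the middle space that embeds well in both. Hence the relation is an equivalence, and completeness
reduces to a rapidly Cauchy sequence of spaces `F n` with finitely supported measures
(`RhoClose.exists_isFinitary`).

For such spaces Hall's theorem turns Lévy-Prokhorov closeness into a partial coupling
(`RhoClose.exists_finite_coupling`). To compose infinitely many couplings, every measure is realised
as the law of a simple function on a set of reals with Lebesgue measure; since this measure has no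
atoms, the next function can be fitted to the one already chosen (`RhoClose.exists_param`). The
errors being summable, up to measure of order `2⁻ᵏ` a parameter is good at all steps from `k` on,
and between good parameters the pulled-back distances vary little below the truncation level.

Their upper limit `D` is a pseudo-distance on the parameters. A Kuratowski map realises it in a
complete space (`DistMeasSpace.exists_of_pseudoDist`), which carries the image of Lebesgue measure
on the eventually good parameters. These parameters couple each `F n` with the limit, and
`RhoClose.of_coupling` gives the convergence. -/

/-! ### Truncating and gluing distances -/

/-- The distance `min L d` on an extended metric space. -/
@[reducible]
noncomputable def truncEMetric (A : Type*) [EMetricSpace A] (L : ℝ≥0∞) (hL : 0 < L) : EMetricSpace A where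
  edist x y := min L (edist x y)
  edist_self x := by simp
  edist_comm x y := by simp [edist_comm]
  edist_triangle x y z := by
    rcases le_total L (edist x y) with h | h
    · exact (min_le_left _ _).trans (by rw [min_eq_left h]; exact le_self_add)
    rcases le_total L (edist y z) with h' | h'
    · exact (min_le_left _ _).trans (by rw [min_eq_left h']; exact le_add_self)
    rw [min_eq_right h, min_eq_right h']
    exact (min_le_right _ _).trans (edist_triangle x y z)
  eq_of_edist_eq_zero {x y} h := by
    rcases min_eq_iff.1 h with h | h
    · exact absurd h.1 hL.ne'
    · exact edist_eq_zero.1 h.1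

section Glue

variable {A B P : Type*} [EMetricSpace A] [EMetricSpace B]

/-- The distance on `A ⊕ B` for which `Φ p` and `Ψ p` are at distance `ε`. -/
noncomputable def glueEDist (Φ : P → A) (Ψ : P → B) (ε : ℝ≥0∞) : A ⊕ B → A ⊕ B → ℝ≥0∞
  | .inl x, .inl y => edist x y
  | .inr x, .inr y => edist x y
  | .inl x, .inr y => (⨅ p, edist x (Φ p) + edist y (Ψ p)) + ε
  | .inr x, .inl y => (⨅ p, edist y (Φ p) + edist x (Ψ p)) + ε

theorem glueEDist_comm (Φ : P → A) (Ψ : P → B) (ε : ℝ≥0∞) (x y : A ⊕ B) :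
    glueEDist Φ Ψ ε x y = glueEDist Φ Ψ ε y x := by
  rcases x with x | x <;> rcases y with y | y <;> simp [glueEDist, edist_comm]

theorem glueEDist_swap (Φ : P → A) (Ψ : P → B) (ε : ℝ≥0∞) (x y : A ⊕ B) :
    glueEDist Ψ Φ ε x.swap y.swap = glueEDist Φ Ψ ε x y := by
  rcases x with x | x <;> rcases y with y | y <;> simp [glueEDist, add_comm]

theorem glueEDist_triangle_inl_inl_inr (Φ : P → A) (Ψ : P → B) (ε : ℝ≥0∞) (x y : A) (z : B) :
    glueEDist Φ Ψ ε (.inl x) (.inr z) ≤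
      glueEDist Φ Ψ ε (.inl x) (.inl y) + glueEDist Φ Ψ ε (.inl y) (.inr z) := by
  simp only [glueEDist]
  rw [← add_assoc, ENNReal.add_iInf]
  refine add_le_add_left (iInf_mono fun p => ?_) ε
  rw [← add_assoc]
  exact add_le_add_left (edist_triangle x y (Φ p)) _

/-- The only kind of triangle that needs `H`: a path crossing at `p` and returning at `q` replaces
the distance of `Φ p` and `Φ q` by that of `Ψ p` and `Ψ q`, and the loss `2 * ε` is paid by the two
crossings. -/
theorem glueEDist_triangle_inl_inr_inl (Φ : P → A) (Ψ : P → B) (ε : ℝ≥0∞)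
    (H : ∀ p q, edist (Φ p) (Φ q) ≤ edist (Ψ p) (Ψ q) + 2 * ε) (x z : A) (y : B) :
    glueEDist Φ Ψ ε (.inl x) (.inl z) ≤
      glueEDist Φ Ψ ε (.inl x) (.inr y) + glueEDist Φ Ψ ε (.inr y) (.inl z) := by
  simp only [glueEDist]
  rw [add_add_add_comm, ← two_mul, ENNReal.iInf_add, ENNReal.iInf_add]
  refine le_iInf fun p => ?_
  rw [ENNReal.add_iInf, ENNReal.iInf_add]
  refine le_iInf fun q => ?_
  calc edist x z ≤ edist x (Φ p) + edist (Φ p) (Φ q) + edist (Φ q) z := edist_triangle4 ..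
    _ ≤ edist x (Φ p) + (edist (Ψ p) y + edist y (Ψ q) + 2 * ε) + edist (Φ q) z := by
        gcongr
        exact (H p q).trans (by gcongr; exact edist_triangle ..)
    _ = _ := by rw [edist_comm (Ψ p) y, edist_comm (Φ q) z]; ring

/-- Two extended metric spaces glued along maps which almost define the same distance. -/
@[reducible]
noncomputable def glueEMetric (Φ : P → A) (Ψ : P → B) (ε : ℝ≥0∞) (hε : 0 < ε)
    (H : ∀ p q, edist (Φ p) (Φ q) ≤ edist (Ψ p) (Ψ q) + 2 * ε)
    (H' : ∀ p q, edist (Ψ p) (Ψ q) ≤ edist (Φ p) (Φ q) + 2 * ε) : EMetricSpace (A ⊕ B) where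
  edist := glueEDist Φ Ψ ε
  edist_self x := by rcases x with x | x <;> simp [glueEDist]
  edist_comm := glueEDist_comm Φ Ψ ε
  edist_triangle x y z := by
    rcases x with x | x <;> rcases y with y | y <;> rcases z with z | z
    -- Up to reversing the triangle and swapping `A` with `B`, only three kinds of triangles occur.
    · exact edist_triangle x y z
    · exact glueEDist_triangle_inl_inl_inr Φ Ψ ε x y z
    · exact glueEDist_triangle_inl_inr_inl Φ Ψ ε H x z y
    · have := glueEDist_triangle_inl_inl_inr Ψ Φ ε z y x
      rw [glueEDist_comm, add_comm, glueEDist_comm Ψ Φ ε _ (.inl y), glueEDist_comm Ψ Φ ε _ (.inr x)]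
        at this
      simpa only [← glueEDist_swap Φ Ψ, glueEDist_comm, Sum.swap_inl, Sum.swap_inr] using this
    · have := glueEDist_triangle_inl_inl_inr Φ Ψ ε z y x
      rwa [glueEDist_comm, add_comm, glueEDist_comm Φ Ψ ε _ (.inl y),
        glueEDist_comm Φ Ψ ε _ (.inr x)] at this
    · have := glueEDist_triangle_inl_inr_inl Ψ Φ ε H' x z y
      simpa only [← glueEDist_swap Φ Ψ, Sum.swap_inl, Sum.swap_inr] using this
    · have := glueEDist_triangle_inl_inl_inr Ψ Φ ε x y z
      simpa only [← glueEDist_swap Φ Ψ, Sum.swap_inl, Sum.swap_inr] using this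
    · exact edist_triangle x y z
  eq_of_edist_eq_zero {x y} h := by
    rcases x with x | x <;> rcases y with y | y
    · rw [edist_eq_zero.1 (h : edist x y = 0)]
    · exact absurd (add_eq_zero.1 h).2 hε.ne'
    · exact absurd (add_eq_zero.1 h).2 hε.ne'
    · rw [edist_eq_zero.1 (h : edist x y = 0)]

end Glue

/-- Two spaces with distances truncated at `L` embed in a common space in which `Φ p` and `Ψ p`
are at distance at most `ε`, if the truncated distances of the images agree up to `2 ε`. -/
theorem exists_glue_trunc {A B : Type u} {P : Type*} [EMetricSpace A] [EMetricSpace B]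
    (Φ : P → A) (Ψ : P → B) (L ε : ℝ≥0∞) (hL : 0 < L) (hε : 0 < ε)
    (H : ∀ p q, min L (edist (Φ p) (Φ q)) ≤ edist (Ψ p) (Ψ q) + 2 * ε)
    (H' : ∀ p q, min L (edist (Ψ p) (Ψ q)) ≤ edist (Φ p) (Φ q) + 2 * ε) :
    ∃ (Z : Type u) (_ : EMetricSpace Z) (_ : MeasurableSpace Z) (_ : BorelSpace Z)
      (i : A → Z) (j : B → Z), (∀ x y, edist (i x) (i y) = min L (edist x y)) ∧
      (∀ x y, edist (j x) (j y) = min L (edist x y)) ∧ ∀ p, edist (i (Φ p)) (j (Ψ p)) ≤ ε := by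
  -- Gluing compares truncated distances on both sides; truncating the right-hand one is free, since
  -- the left-hand one never exceeds `L`.
  have key : ∀ s t : ℝ≥0∞, min L s ≤ t + 2 * ε → min L s ≤ min L t + 2 * ε := fun s t h => by
    rcases le_total L t with h' | h'
    · rw [min_eq_left h']; exact (min_le_left _ _).trans le_self_add
    · rwa [min_eq_right h']
  let m := @glueEMetric A B P (truncEMetric A L hL) (truncEMetric B L hL) Φ Ψ ε hε
    (fun p q => key _ _ (H p q)) (fun p q => key _ _ (H' p q))
  refine ⟨A ⊕ B, m, @borel _ m.toUniformSpace.toTopologicalSpace,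
    @BorelSpace.mk _ m.toUniformSpace.toTopologicalSpace
      (@borel _ m.toUniformSpace.toTopologicalSpace) rfl,
    Sum.inl, Sum.inr, fun _ _ => rfl, fun _ _ => rfl, fun p => ?_⟩
  change (⨅ q, min L (edist (Φ p) (Φ q)) + min L (edist (Ψ p) (Ψ q))) + ε ≤ ε
  have : (⨅ q, min L (edist (Φ p) (Φ q)) + min L (edist (Ψ p) (Ψ q))) ≤ 0 :=
    (iInf_le _ p).trans (by simp)
  rw [nonpos_iff_eq_zero.1 this, zero_add]

/-! ### Closeness with a single error parameter -/

theorem exists_edist_lt_of_mem_thickening {Z : Type*} [PseudoEMetricSpace Z] {a : ℝ≥0}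
    {B : Set Z} {z : Z} : z ∈ Metric.thickening a B ↔ ∃ b ∈ B, edist z b < a := by
  rw [Metric.mem_thickening_iff_exists_edist_lt, ENNReal.ofReal_coe_nnreal]

/-- `f` and `g` embed `X` and `Y` in `Z`, up to distance `a⁻¹` and up to sets of measure `a`, in
such a way that the images of the measures are `a`-close for the Levy-Prokhorov distance. -/
structure RhoClose.Embeds (a : ℝ≥0) (X Y : DistMeasSpace.{u}) {Z : Type u} [EMetricSpace Z]
    [MeasurableSpace Z] (f : X → Z) (g : Y → Z) : Prop where
  measurable_left : Measurable f
  measurable_right : Measurable g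
  isometry_left : ∃ E : Set X, MeasurableSet E ∧ X.μ E ≤ a ∧ ∀ x ∉ E, ∀ y ∉ E,
    min (a : ℝ≥0∞)⁻¹ (edist (f x) (f y)) = min (a : ℝ≥0∞)⁻¹ (edist x y)
  isometry_right : ∃ E : Set Y, MeasurableSet E ∧ Y.μ E ≤ a ∧ ∀ x ∉ E, ∀ y ∉ E,
    min (a : ℝ≥0∞)⁻¹ (edist (g x) (g y)) = min (a : ℝ≥0∞)⁻¹ (edist x y)
  measure_left_le : ∀ B, MeasurableSet B →
    X.μ (f ⁻¹' B) ≤ Y.μ (g ⁻¹' Metric.thickening a B) + a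
  measure_right_le : ∀ B, MeasurableSet B →
    Y.μ (g ⁻¹' B) ≤ X.μ (f ⁻¹' Metric.thickening a B) + a

/-- `X` and `Y` have embeddings in a common space with all the errors at most `a`. -/
def RhoClose (a : ℝ≥0) (X Y : DistMeasSpace.{u}) : Prop :=
  ∃ (Z : Type u) (_ : EMetricSpace Z) (_ : MeasurableSpace Z) (_ : BorelSpace Z)
    (f : X → Z) (g : Y → Z), RhoClose.Embeds a X Y f g

namespace RhoClose

variable {a b : ℝ≥0} {X Y W : DistMeasSpace.{u}}

theorem Embeds.symm {Z : Type u} [EMetricSpace Z] [MeasurableSpace Z] {f : X → Z} {g : Y → Z}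
    (h : Embeds a X Y f g) : Embeds a Y X g f :=
  ⟨h.2, h.1, h.4, h.3, h.6, h.5⟩

theorem min_eq_min_of_le {L L' s t : ℝ≥0∞} (h : L' ≤ L) (hs : min L s = min L t) :
    min L' s = min L' t := by
  rw [← min_eq_left h, min_assoc, min_assoc, hs]

theorem Embeds.mono {Z : Type u} [EMetricSpace Z] [MeasurableSpace Z] {f : X → Z} {g : Y → Z}
    (h : Embeds a X Y f g) (hab : a ≤ b) : Embeds b X Y f g := by
  have hab' : (a : ℝ≥0∞) ≤ b := by exact_mod_cast hab
  have hi := ENNReal.inv_le_inv.2 hab'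
  obtain ⟨E, hE, hEa, hEi⟩ := h.3
  obtain ⟨F, hF, hFa, hFi⟩ := h.4
  exact ⟨h.1, h.2, ⟨E, hE, hEa.trans hab', fun x hx y hy => min_eq_min_of_le hi (hEi x hx y hy)⟩,
    ⟨F, hF, hFa.trans hab', fun x hx y hy => min_eq_min_of_le hi (hFi x hx y hy)⟩,
    fun B hB => (h.5 B hB).trans (by gcongr),
    fun B hB => (h.6 B hB).trans (by gcongr)⟩

theorem symm (h : RhoClose a X Y) : RhoClose a Y X := by
  obtain ⟨Z, _, _, _, f, g, h⟩ := h
  exact ⟨Z, _, _, ‹_›, g, f, h.symm⟩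

theorem mono (h : RhoClose a X Y) (hab : a ≤ b) : RhoClose b X Y := by
  obtain ⟨Z, _, _, _, f, g, h⟩ := h
  exact ⟨Z, _, _, ‹_›, f, g, h.mono hab⟩

theorem refl (a : ℝ≥0) (ha : 0 < a) (X : DistMeasSpace.{u}) : RhoClose a X X := by
  refine ⟨X, _, _, X.borel, id, id, measurable_id, measurable_id, ⟨∅, by simp⟩, ⟨∅, by simp⟩, ?_, ?_⟩ <;>
  · intro B _
    refine le_add_right (measure_mono ?_)
    exact Metric.self_subset_thickening (by exact_mod_cast ha) B

/-- Two values that must agree once either is below `L` are two values with the same truncation at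
`L`; in this form the condition is stable under truncating the ambient distance. -/
theorem isLIsometricOn_iff {M N : Type*} [EMetricSpace M] [EMetricSpace N] {L : ℝ} {f : M → N}
    {s : Set M} : IsLIsometricOn L f s ↔ ∀ x ∈ s, ∀ y ∈ s,
      min (ENNReal.ofReal L) (edist (f x) (f y)) = min (ENNReal.ofReal L) (edist x y) := by
  refine forall₄_congr fun x _ y _ => ?_
  generalize edist (f x) (f y) = p
  generalize edist x y = q
  generalize ENNReal.ofReal L = L
  grind

/-- Taking `L = a⁻¹`, each of the three terms in `dRho` is at most `a`. -/
theorem dRho_le (ha : 0 < a) (h : RhoClose a X Y) : dRho X Y ≤ 3 * a := by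
  obtain ⟨Z, _, _, _, f, g, hf, hg, ⟨E, hE, hEa, hEi⟩, ⟨F, hF, hFa, hFi⟩, h1, h2⟩ := h
  have hL : ENNReal.ofReal ((a : ℝ)⁻¹) = (a : ℝ≥0∞)⁻¹ := by
    rw [ENNReal.ofReal_inv_of_pos (by exact_mod_cast ha), ENNReal.ofReal_coe_nnreal]
  have : levyProkhorovEDist (X.μ.map f) (Y.μ.map g) ≤ a := by
    refine sInf_le fun B hB => ?_
    have ht : MeasurableSet (Metric.thickening (a : ℝ) B) := Metric.isOpen_thickening.measurableSet
    rw [ENNReal.coe_toReal, Measure.map_apply hf hB, Measure.map_apply hg hB,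
      Measure.map_apply hf ht, Measure.map_apply hg ht]
    exact ⟨h1 B hB, h2 B hB⟩
  calc dRho X Y ≤ levyProkhorovEDist (X.μ.map f) (Y.μ.map g) + ENNReal.ofReal (1 / (a : ℝ)⁻¹) + a := by
        refine sInf_le ⟨Z, _, _, ‹_›, (a : ℝ)⁻¹, a, f, g, by positivity,
          ⟨hf, E, hE, hEa, isLIsometricOn_iff.2 ?_⟩, ⟨hg, F, hF, hFa, isLIsometricOn_iff.2 ?_⟩, rfl⟩
        · rw [hL]; exact hEi
        · rw [hL]; exact hFi
    _ ≤ a + a + a := by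
        gcongr
        simp
    _ = 3 * a := by ring

theorem of_dRho_lt (h : dRho X Y < a) : RhoClose a X Y := by
  obtain ⟨_, ⟨Z, _, _, _, L, ε, f, g, hL, ⟨hf, E, hE, hEa, hEi⟩, ⟨hg, F, hF, hFa, hFi⟩, rfl⟩, h⟩ :=
    sInf_lt_iff.1 h
  have h1 : levyProkhorovEDist (X.μ.map f) (Y.μ.map g) < a :=
    (le_self_add.trans le_self_add).trans_lt h
  have h2 : (a : ℝ≥0∞)⁻¹ ≤ ENNReal.ofReal L := by
    have : ENNReal.ofReal (1 / L) < a := (le_add_self.trans le_self_add).trans_lt h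
    rw [one_div, ENNReal.ofReal_inv_of_pos hL] at this
    exact (ENNReal.inv_le_iff_inv_le.1 this.le)
  have h3 : (ε : ℝ≥0∞) ≤ a := (le_add_self.trans_lt h).le
  refine ⟨Z, _, _, ‹_›, f, g, hf, hg, ⟨E, hE, hEa.trans h3, fun x hx y hy =>
    min_eq_min_of_le h2 (isLIsometricOn_iff.1 hEi x hx y hy)⟩, ⟨F, hF, hFa.trans h3, fun x hx y hy =>
    min_eq_min_of_le h2 (isLIsometricOn_iff.1 hFi x hx y hy)⟩, fun B hB => ?_, fun B hB => ?_⟩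
  · have := left_measure_le_of_levyProkhorovEDist_lt h1 hB
    rwa [Measure.map_apply hf hB, Measure.map_apply hg Metric.isOpen_thickening.measurableSet] at this
  · have := right_measure_le_of_levyProkhorovEDist_lt h1 hB
    rwa [Measure.map_apply hg hB, Measure.map_apply hf Metric.isOpen_thickening.measurableSet] at this

/-- Chaining two Levy-Prokhorov inequalities through maps into a third space. -/
theorem measure_le_of_chain {U V Z : Type*} [EMetricSpace U] [MeasurableSpace U] [BorelSpace U]
    [EMetricSpace V] [MeasurableSpace V] [BorelSpace V] [EMetricSpace Z] [MeasurableSpace Z]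
    [BorelSpace Z] {i : U → Z} {j : V → Z}
    (hi : ∀ x y, edist (i x) (i y) ≤ edist x y) (hj : ∀ x y, edist (j x) (j y) ≤ edist x y)
    {f : X → U} {g₁ : Y → U} {g₂ : Y → V} {h : W → V} (ha : 0 < a)
    (hfg : ∀ B, MeasurableSet B → X.μ (f ⁻¹' B) ≤ Y.μ (g₁ ⁻¹' Metric.thickening a B) + a)
    (hgh : ∀ B, MeasurableSet B → Y.μ (g₂ ⁻¹' B) ≤ W.μ (h ⁻¹' Metric.thickening a B) + a)
    {E : Set Y} (hE : Y.μ E ≤ 2 * a) (hd : ∀ y ∉ E, edist (i (g₁ y)) (j (g₂ y)) ≤ a)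
    {B : Set Z} (hB : MeasurableSet B) :
    X.μ ((i ∘ f) ⁻¹' B) ≤ W.μ ((j ∘ h) ⁻¹' Metric.thickening (4 * a : ℝ≥0) B) + (4 * a : ℝ≥0) := by
  have hic : Continuous i := LipschitzWith.continuous (K := 1) fun x y => by simpa using hi x y
  have hjc : Continuous j := LipschitzWith.continuous (K := 1) fun x y => by simpa using hj x y
  -- The radius grows by `a` in `U`, in the crossing and in `V`, so `3 * a` would do; the factor 4
  -- comes from the measures, with errors `a`, `2 * a` for `E`, and `a`.
  set C := Metric.thickening (a : ℝ) (i ⁻¹' B)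
  set B' := Metric.thickening ((2 * a : ℝ≥0) : ℝ) B
  have hB' : MeasurableSet (j ⁻¹' B') := (Metric.isOpen_thickening.preimage hjc).measurableSet
  have hsub : g₁ ⁻¹' C ⊆ g₂ ⁻¹' (j ⁻¹' B') ∪ E := by
    intro y hy
    by_cases hyE : y ∈ E
    · exact Or.inr hyE
    obtain ⟨b, hb, hyb⟩ := exists_edist_lt_of_mem_thickening.1 hy
    refine Or.inl (exists_edist_lt_of_mem_thickening.2 ⟨i b, hb, ?_⟩)
    calc edist (j (g₂ y)) (i b) ≤ edist (j (g₂ y)) (i (g₁ y)) + edist (i (g₁ y)) (i b) :=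
          edist_triangle ..
      _ < a + a := by
          have := hd y hyE
          rw [edist_comm] at this
          exact ENNReal.add_lt_add_of_le_of_lt (ne_top_of_le_ne_top ENNReal.coe_ne_top this) this
            ((hi _ _).trans_lt hyb)
      _ = (2 * a : ℝ≥0) := by push_cast; ring
  have hsub' : h ⁻¹' Metric.thickening a (j ⁻¹' B') ⊆
      (j ∘ h) ⁻¹' Metric.thickening (4 * a : ℝ≥0) B := by
    intro w hw
    obtain ⟨v, hv, hwv⟩ := exists_edist_lt_of_mem_thickening.1 hw
    obtain ⟨b, hb, hvb⟩ := exists_edist_lt_of_mem_thickening.1 hv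
    refine exists_edist_lt_of_mem_thickening.2 ⟨b, hb, ?_⟩
    calc edist (j (h w)) b ≤ edist (j (h w)) (j v) + edist (j v) b := edist_triangle ..
      _ < a + (2 * a : ℝ≥0) := ENNReal.add_lt_add ((hj _ _).trans_lt hwv) hvb
      _ ≤ (4 * a : ℝ≥0) := by
          rw [← ENNReal.coe_add]
          gcongr
          nlinarith [a.2]
  calc X.μ (f ⁻¹' (i ⁻¹' B)) ≤ Y.μ (g₁ ⁻¹' C) + a := hfg _ (hic.measurable hB)
    _ ≤ (Y.μ (g₂ ⁻¹' (j ⁻¹' B')) + Y.μ E) + a := by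
        gcongr; exact (measure_mono hsub).trans (measure_union_le _ _)
    _ ≤ (W.μ ((j ∘ h) ⁻¹' Metric.thickening (4 * a : ℝ≥0) B) + a + 2 * a) + a := by
        gcongr; exact (hgh _ hB').trans (by gcongr)
    _ = _ := by push_cast; ring

/-- The two ambient spaces are glued along the images of `Y` minus both of its exceptional sets,
where the distances truncated at `a⁻¹` agree. The exceptional sets of `Y` then only cost measure,
and those of `X` and `W` are kept. -/
theorem trans (ha : 0 < a) (h₁ : RhoClose a X Y) (h₂ : RhoClose a Y W) : RhoClose (4 * a) X W := by
  obtain ⟨U, _, _, _, f, g₁, hfm, hg₁m, ⟨E, hE, hEa, hEi⟩, ⟨F, hF, hFa, hFi⟩, h1, h2⟩ := h₁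
  obtain ⟨V, _, _, _, g₂, h, hg₂m, hhm, ⟨F', hF', hFa', hFi'⟩, ⟨H, hH, hHa, hHi⟩, h3, h4⟩ := h₂
  have ha' : (0 : ℝ≥0∞) < a := by exact_mod_cast ha
  have hL : (0 : ℝ≥0∞) < (a : ℝ≥0∞)⁻¹ := by simp
  obtain ⟨Z, _, _, _, i, j, hl, hr, hlr⟩ := exists_glue_trunc (P := ((F ∪ F')ᶜ : Set Y)) (fun p => g₁ p)
    (fun p => g₂ p) (a : ℝ≥0∞)⁻¹ a hL ha'
    (fun p q => by
      rw [hFi p (fun h => p.2 (.inl h)) q (fun h => q.2 (.inl h)),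
        ← hFi' p (fun h => p.2 (.inr h)) q (fun h => q.2 (.inr h))]
      exact (min_le_right _ _).trans le_self_add)
    (fun p q => by
      rw [hFi' p (fun h => p.2 (.inr h)) q (fun h => q.2 (.inr h)),
        ← hFi p (fun h => p.2 (.inl h)) q (fun h => q.2 (.inl h))]
      exact (min_le_right _ _).trans le_self_add)
  have hl' : ∀ x y : U, edist (i x) (i y) ≤ edist x y :=
    fun x y => (hl x y).trans_le (min_le_right _ _)
  have hr' : ∀ x y : V, edist (j x) (j y) ≤ edist x y :=
    fun x y => (hr x y).trans_le (min_le_right _ _)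
  have hlm : Measurable (i : U → Z) := by
    refine Continuous.measurable ?_
    exact LipschitzWith.continuous (K := 1) fun x y => by simpa using hl' x y
  have hrm : Measurable (j : V → Z) := by
    refine Continuous.measurable ?_
    exact LipschitzWith.continuous (K := 1) fun x y => by simpa using hr' x y
  have h4a : (a : ℝ≥0∞) ≤ (4 * a : ℝ≥0) := by
    norm_cast
    exact le_mul_of_one_le_left a.2 (by norm_num)
  have hinv : ((4 * a : ℝ≥0) : ℝ≥0∞)⁻¹ ≤ (a : ℝ≥0∞)⁻¹ := ENNReal.inv_le_inv.2 h4a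
  have hFF : Y.μ (F ∪ F') ≤ 2 * a :=
    (measure_union_le _ _).trans (by rw [two_mul]; gcongr)
  have hmm : ∀ s : ℝ≥0∞, min (a : ℝ≥0∞)⁻¹ (min (a : ℝ≥0∞)⁻¹ s) = min (a : ℝ≥0∞)⁻¹ s := fun s => by
    rw [← min_assoc, min_self]
  refine ⟨Z, _, _, ‹_›, i ∘ f, j ∘ h, hlm.comp hfm, hrm.comp hhm,
    ⟨E, hE, hEa.trans h4a, fun x hx y hy => min_eq_min_of_le hinv ?_⟩,
    ⟨H, hH, hHa.trans h4a, fun x hx y hy => min_eq_min_of_le hinv ?_⟩, fun B hB => ?_, fun B hB => ?_⟩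
  · rw [Function.comp, Function.comp, hl, hmm, hEi x hx y hy]
  · rw [Function.comp, Function.comp, hr, hmm, hHi x hx y hy]
  · exact measure_le_of_chain hl' hr' ha h1 h3 hFF (fun y hy => hlr ⟨y, hy⟩) hB
  · exact measure_le_of_chain hr' hl' ha h4 h2 hFF
      (fun y hy => by rw [edist_comm]; exact hlr ⟨y, hy⟩) hB

/-- Two spaces are close if their measures are almost the images of a common measure under maps
which almost define the same truncated distance. -/
theorem of_coupling {T : Type*} [MeasurableSpace T] (P : Measure T) (ha : 0 < a) {G : Set T}
    {φ : T → X} {ψ : T → Y}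
    (h : ∀ p ∈ G, ∀ q ∈ G, min (a : ℝ≥0∞)⁻¹ (edist (φ p) (φ q)) ≤ edist (ψ p) (ψ q) + 2 * a)
    (h' : ∀ p ∈ G, ∀ q ∈ G, min (a : ℝ≥0∞)⁻¹ (edist (ψ p) (ψ q)) ≤ edist (φ p) (φ q) + 2 * a)
    (h₁ : ∀ A, MeasurableSet A → X.μ A ≤ P (G ∩ φ ⁻¹' A) + a)
    (h₂ : ∀ A, MeasurableSet A → P (G ∩ φ ⁻¹' A) ≤ X.μ A)
    (h₃ : ∀ A, MeasurableSet A → Y.μ A ≤ P (G ∩ ψ ⁻¹' A) + a)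
    (h₄ : ∀ A, MeasurableSet A → P (G ∩ ψ ⁻¹' A) ≤ Y.μ A) : RhoClose (2 * a) X Y := by
  have ha' : (0 : ℝ≥0∞) < a := by exact_mod_cast ha
  have hL : (0 : ℝ≥0∞) < (a : ℝ≥0∞)⁻¹ := by simp
  obtain ⟨Z, _, _, _, i, j, hl, hr, hlr⟩ := exists_glue_trunc (P := G) (fun p => φ p)
    (fun p => ψ p) (a : ℝ≥0∞)⁻¹ a hL ha' (fun p q => h p p.2 q q.2) (fun p q => h' p p.2 q q.2)
  have hlm : Measurable (i : X → Z) := by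
    refine Continuous.measurable ?_
    exact LipschitzWith.continuous (K := 1) fun x y => by simp [hl]
  have hrm : Measurable (j : Y → Z) := by
    refine Continuous.measurable ?_
    exact LipschitzWith.continuous (K := 1) fun x y => by simp [hr]
  have h2a : (a : ℝ≥0∞) ≤ (2 * a : ℝ≥0) := by
    norm_cast
    exact le_mul_of_one_le_left a.2 (by norm_num)
  -- Glued points are at distance at most `a`, while thickenings are defined by a strict inequality;
  -- hence the doubled parameter.
  have h2a' : (a : ℝ≥0∞) < (2 * a : ℝ≥0) := by
    norm_cast
    exact lt_mul_of_one_lt_left ha (by norm_num)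
  have hinv : ((2 * a : ℝ≥0) : ℝ≥0∞)⁻¹ ≤ (a : ℝ≥0∞)⁻¹ := ENNReal.inv_le_inv.2 h2a
  have hmm : ∀ s : ℝ≥0∞, min (a : ℝ≥0∞)⁻¹ (min (a : ℝ≥0∞)⁻¹ s) = min (a : ℝ≥0∞)⁻¹ s := fun s => by
    rw [← min_assoc, min_self]
  refine ⟨Z, _, _, ‹_›, i, j, hlm, hrm,
    ⟨∅, .empty, by simp, fun x _ y _ => min_eq_min_of_le hinv (by rw [hl, hmm])⟩,
    ⟨∅, .empty, by simp, fun x _ y _ => min_eq_min_of_le hinv (by rw [hr, hmm])⟩,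
    fun B hB => ?_, fun B hB => ?_⟩
  · refine (h₁ _ (hlm hB)).trans (add_le_add ((measure_mono ?_).trans (h₄ _ (hrm
      Metric.isOpen_thickening.measurableSet))) h2a)
    rintro t ⟨htG, ht⟩
    refine ⟨htG, exists_edist_lt_of_mem_thickening.2 ⟨_, ht, ?_⟩⟩
    rw [edist_comm]
    exact (hlr ⟨t, htG⟩).trans_lt h2a'
  · refine (h₃ _ (hrm hB)).trans (add_le_add ((measure_mono ?_).trans (h₂ _ (hlm
      Metric.isOpen_thickening.measurableSet))) h2a)
    rintro t ⟨htG, ht⟩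
    exact ⟨htG, exists_edist_lt_of_mem_thickening.2 ⟨_, ht, (hlr ⟨t, htG⟩).trans_lt h2a'⟩⟩

end RhoClose

/-! ### Approximation by finitely supported measures -/

/-- The space `X` with its measure replaced by another finite measure. -/
noncomputable def DistMeasSpace.withMeasure (X : DistMeasSpace.{u}) (ν : Measure X)
    [IsFiniteMeasure ν] : DistMeasSpace.{u} :=
  -- With completeness, this makes regularity of the finite measure automatic.
  haveI : SecondCountableTopology X := UniformSpace.secondCountable_of_separable X
  { carrier := X, μ := ν }

/-- `X` has a point, and its measure is concentrated on a finite set. -/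
def DistMeasSpace.IsFinitary (X : DistMeasSpace.{u}) : Prop :=
  Nonempty X ∧ ∃ S : Finset X, X.μ (Sᶜ : Set X) = 0

/-- Moving each point to the nearest among finitely many terms of a dense sequence displaces it by
less than `a`, off a set of small measure. -/
theorem RhoClose.exists_isFinitary (X : DistMeasSpace.{u}) {a : ℝ≥0} (ha : 0 < a) :
    ∃ F : DistMeasSpace.{u}, F.IsFinitary ∧ RhoClose (2 * a) X F := by
  have ha' : (0 : ℝ≥0∞) < a := by exact_mod_cast ha
  rcases isEmpty_or_nonempty X with hX | hX
  -- The empty space is replaced by a point of measure zero, since simple functions will need a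
  -- default value.
  · let _ : EMetricSpace PUnit.{u + 1} := EMetricSpace.ofT0PseudoEMetricSpace _
    let _ : MeasurableSpace PUnit.{u + 1} := borel _
    have _ : BorelSpace PUnit.{u + 1} := ⟨rfl⟩
    refine ⟨{ carrier := PUnit, μ := 0 }, ⟨⟨PUnit.unit⟩, ∅, ?_⟩,
      of_coupling (T := X) X.μ ha (G := univ) (φ := id) (ψ := fun _ => PUnit.unit)
        (fun p => isEmptyElim p) (fun p => isEmptyElim p) ?_ ?_ ?_ ?_⟩
    · simp
    all_goals intro A _; simp [Measure.eq_zero_of_isEmpty X.μ]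
  have : SecondCountableTopology X := UniformSpace.secondCountable_of_separable X
  let e : ℕ → X := TopologicalSpace.denseSeq X
  let r : ℕ → SimpleFunc X X := fun N => SimpleFunc.nearestPt e N
  let G : ℕ → Set X := fun N => {x | edist (r N x) x < a}
  have hG : ∀ N, MeasurableSet (G N) := fun N =>
    measurableSet_lt ((r N).measurable.edist measurable_id) measurable_const
  have hmono : Monotone G := by
    intro M N hMN x hx
    exact (SimpleFunc.edist_nearestPt_le e x
      ((SimpleFunc.nearestPtInd_le e M x).trans hMN)).trans_lt hx
  have hun : ⋃ N, G N = univ := by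
    refine eq_univ_of_forall fun x => ?_
    obtain ⟨_, hk, k, rfl⟩ := EMetric.dense_iff.1 (TopologicalSpace.denseRange_denseSeq X) x a ha'
    refine mem_iUnion.2 ⟨k, (SimpleFunc.edist_nearestPt_le e x le_rfl).trans_lt ?_⟩
    simpa using hk
  obtain ⟨N, hN⟩ : ∃ N, X.μ (G N)ᶜ < a := by
    have := tendsto_measure_iInter_atTop (μ := X.μ) (s := fun N => (G N)ᶜ)
      (fun N => (hG N).compl.nullMeasurableSet) (fun M N h => compl_subset_compl.2 (hmono h))
      ⟨0, measure_ne_top _ _⟩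
    rw [← compl_iUnion, hun, compl_univ, measure_empty] at this
    exact (this.eventually (gt_mem_nhds ha')).exists
  have hm : ∀ A, MeasurableSet A →
      (X.μ.restrict (G N)).map (r N) A = X.μ (G N ∩ r N ⁻¹' A) := fun A hA => by
    rw [Measure.map_apply (r N).measurable hA,
      Measure.restrict_apply ((r N).measurable hA), inter_comm]
  -- The mass outside `G N` is discarded, so the new measure is exactly the image of the coupling.
  refine ⟨X.withMeasure ((X.μ.restrict (G N)).map (r N)), ⟨hX, (r N).range, ?_⟩,
    of_coupling X.μ ha (G := G N) (φ := id) (ψ := r N) ?_ ?_ ?_ ?_ ?_ ?_⟩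
  · refine (hm _ (r N).range.measurableSet.compl).trans ?_
    convert measure_empty (μ := X.μ)
    ext x
    simp
  · intro p hp q hq
    refine (min_le_right _ _).trans ?_
    calc edist p q ≤ edist p (r N p) + edist (r N p) (r N q) + edist (r N q) q := edist_triangle4 ..
      _ ≤ a + edist (r N p) (r N q) + a := by
          rw [edist_comm p]
          gcongr
          · exact hp.le
          · exact hq.le
      _ = edist (r N p) (r N q) + 2 * a := by ring
  · intro p hp q hq
    refine (min_le_right _ _).trans ?_
    calc edist (r N p) (r N q) ≤ edist (r N p) p + edist p q + edist q (r N q) := edist_triangle4 ..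
      _ ≤ a + edist p q + a := by
          rw [edist_comm q]
          gcongr
          · exact hp.le
          · exact hq.le
      _ = edist p q + 2 * a := by ring
  · intro A hA
    calc X.μ A ≤ X.μ (G N ∩ A) + X.μ (G N)ᶜ := by
          refine (measure_mono fun x hx => ?_).trans (measure_union_le _ _)
          by_cases h : x ∈ G N
          exacts [.inl ⟨h, hx⟩, .inr h]
      _ ≤ _ := by gcongr; exact subset_rfl
  · exact fun A _ => measure_mono inter_subset_right
  · exact fun A hA => (hm A hA).le.trans le_self_add
  · exact fun A hA => (hm A hA).ge

/-! ### Transport between finite sets from Hall's theorem -/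

open Finset in
/-- A weighted form of Hall's marriage theorem with integral weights and a deficiency. -/
theorem exists_nat_transport {α β : Type*} [DecidableEq α] [DecidableEq β] (S : Finset α)
    (T : Finset β) (R : α → β → Prop) [DecidableRel R] (u : α → ℕ) (v : β → ℕ) (d : ℕ)
    (h : ∀ A ⊆ S, ∑ x ∈ A, u x ≤ ∑ y ∈ T with ∃ x ∈ A, R x y, v y + d) :
    ∃ p : α → β → ℕ, (∀ x y, p x y ≠ 0 → R x y) ∧ (∀ x ∈ S, ∑ y ∈ T, p x y ≤ u x) ∧
      (∀ y ∈ T, ∑ x ∈ S, p x y ≤ v y) ∧ ∑ x ∈ S, u x ≤ ∑ x ∈ S, ∑ y ∈ T, p x y + d := by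
  -- Every point is replaced by as many copies as its weight, and `d` dummies related to everything
  -- absorb the deficiency. A matching of `I` into `J` is then a transport plan.
  let I := Σ x : S, Fin (u x)
  let J := (Σ y : T, Fin (v y)) ⊕ Fin d
  let r : I → J → Prop := fun i j => Sum.elim (fun y => R i.1 y.1) (fun _ => True) j
  classical
  obtain ⟨f, hf, hfr⟩ := (Fintype.all_card_le_filter_rel_iff_exists_injective r).1 (by
    intro A
    -- The dummies are neighbours of `A` only if `A` has an element.
    rcases A.eq_empty_or_nonempty with rfl | ⟨i₀, hi₀⟩
    · simp
    let A' : Finset α := A.image fun i => (i.1 : α)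
    have hA' : A' ⊆ S := by
      intro x hx
      obtain ⟨i, -, rfl⟩ := Finset.mem_image.1 hx
      exact i.1.2
    have h1 : #A ≤ ∑ x ∈ A', u x := by
      calc #A ≤ ∑ x ∈ A', #{i ∈ A | (i.1 : α) = x} := by
            rw [Finset.card_eq_sum_card_image (fun i : I => (i.1 : α)) A]
        _ ≤ ∑ x ∈ A', u x := by
            refine Finset.sum_le_sum fun x hx => ?_
            have hxS := hA' hx
            calc #{i ∈ A | (i.1 : α) = x} ≤ #(Finset.univ.image fun k : Fin (u x) =>
                  (⟨⟨x, hxS⟩, k⟩ : I)) := by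
                  refine Finset.card_le_card ?_
                  rintro ⟨⟨x', hx'⟩, k⟩ hi
                  obtain rfl : x' = x := (Finset.mem_filter.1 hi).2
                  exact Finset.mem_image_of_mem _ (Finset.mem_univ k)
              _ ≤ u x := Finset.card_image_le.trans (by simp)
    have h2 : ∑ y ∈ T with ∃ x ∈ A', R x y, v y + d ≤ #{j : J | ∃ i ∈ A, r i j} := by
      let U : Finset T := {y | ∃ x ∈ A', R x y}
      have h3 : ∑ y ∈ T with ∃ x ∈ A', R x y, v y = ∑ y ∈ U, v y := by
        symm
        refine Finset.sum_bij (fun y _ => (y : β)) ?_ ?_ ?_ ?_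
        · intro y hy
          exact Finset.mem_filter.2 ⟨y.2, (Finset.mem_filter.1 hy).2⟩
        · intro y _ y' _ h
          exact Subtype.ext h
        · intro y hy
          exact ⟨⟨y, (Finset.mem_filter.1 hy).1⟩,
            Finset.mem_filter.2 ⟨Finset.mem_univ _, (Finset.mem_filter.1 hy).2⟩, rfl⟩
        · intros; rfl
      calc ∑ y ∈ T with ∃ x ∈ A', R x y, v y + d
          = #((U.sigma fun y => (Finset.univ : Finset (Fin (v y)))).disjSum
            (Finset.univ : Finset (Fin d))) := by
            rw [h3, Finset.card_disjSum, Finset.card_sigma]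
            simp
        _ ≤ _ := by
            refine Finset.card_le_card ?_
            rintro (⟨y, k⟩ | k) hj
            · have hy : y ∈ U := by simpa using hj
              obtain ⟨x, hx, hxy⟩ := (Finset.mem_filter.1 hy).2
              obtain ⟨i, hi, rfl⟩ := Finset.mem_image.1 hx
              exact Finset.mem_filter.2 ⟨Finset.mem_univ _, i, hi, hxy⟩
            · exact Finset.mem_filter.2 ⟨Finset.mem_univ _, i₀, hi₀, trivial⟩
    exact h1.trans ((h A' hA').trans h2))
  -- `q i y` means that `i` is matched with a copy of `y`; the plan counts the copies of `x` with
  -- this property.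
  let q : I → β → Prop := fun i y => Sum.elim (fun j => (j.1 : β) = y) (fun _ => False) (f i)
  have hq : ∀ i, ∑ y ∈ T, (if q i y then 1 else 0) = if (f i).isLeft then 1 else 0 := by
    intro i
    rcases hfi : f i with ⟨z, k⟩ | k
    · have h : ∀ y, q i y ↔ (z : β) = y := fun y => by simp [q, hfi]
      simp [h]
    · have h : ∀ y, ¬ q i y := fun y => by simp [q, hfi]
      simp [h]
  have hS : ∀ i : I, ∑ x ∈ S, (if (i.1 : α) = x then 1 else 0) = 1 := by
    intro i
    simp
  have hp : ∀ x y, #{i : I | (i.1 : α) = x ∧ q i y} =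
      ∑ i : I, (if (i.1 : α) = x then 1 else 0) * (if q i y then 1 else 0) := by
    intro x y
    rw [Finset.card_filter]
    exact Finset.sum_congr rfl fun i _ => by split_ifs <;> simp_all
  refine ⟨fun x y => #{i : I | (i.1 : α) = x ∧ q i y}, ?_, ?_, ?_, ?_⟩
  · intro x y hxy
    obtain ⟨i, hi⟩ := Finset.card_ne_zero.1 hxy
    obtain ⟨-, h1, h2⟩ := Finset.mem_filter.1 hi
    have h3 : Sum.elim (fun j => R i.1 j.1) (fun _ => True) (f i) := hfr i
    have h2 : Sum.elim (fun j => (j.1 : β) = y) (fun _ => False) (f i) := h2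
    rcases hfi : f i with ⟨y', k⟩ | k
    · rw [hfi] at h2 h3
      obtain rfl : (y' : β) = y := h2
      rw [← h1]
      exact h3
    · rw [hfi] at h2
      exact h2.elim
  · intro x hx
    simp only [hp]
    rw [Finset.sum_comm]
    simp only [← Finset.mul_sum, hq]
    calc ∑ i : I, (if (i.1 : α) = x then 1 else 0) * (if (f i).isLeft then 1 else 0)
        ≤ ∑ i : I, (if (i.1 : α) = x then 1 else 0) :=
          Finset.sum_le_sum fun i _ => by split_ifs <;> simp
      _ = u x := by
          have hz : ∀ z : S, ∑ k : Fin (u z), (if ((⟨z, k⟩ : I).1 : α) = x then 1 else 0) =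
              if (z : α) = x then u z else 0 := fun z => by
            by_cases hz : (z : α) = x <;> simp [hz]
          rw [Fintype.sum_sigma, Finset.sum_congr rfl fun z _ => hz z]
          rw [Finset.sum_coe_sort S (fun z => if z = x then u z else 0)]
          simp [hx]
  · intro y hy
    simp only [hp]
    rw [Finset.sum_comm]
    simp only [← Finset.sum_mul, hS, one_mul]
    rw [← Finset.card_filter]
    calc #{i : I | q i y} = #(Finset.image f {i : I | q i y}) :=
          (Finset.card_image_of_injective _ hf).symm
      _ ≤ #(Finset.univ.image fun k : Fin (v y) => (Sum.inl ⟨⟨y, hy⟩, k⟩ : J)) := by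
          refine Finset.card_le_card ?_
          intro j hj
          obtain ⟨i, hi, rfl⟩ := Finset.mem_image.1 hj
          have hi := (Finset.mem_filter.1 hi).2
          simp only [q] at hi
          rcases hfi : f i with ⟨⟨y', hy'⟩, k⟩ | k
          · rw [hfi] at hi
            obtain rfl : y' = y := hi
            exact Finset.mem_image_of_mem _ (Finset.mem_univ k)
          · rw [hfi] at hi
            exact hi.elim
      _ ≤ v y := Finset.card_image_le.trans (by simp)
  · have htot : ∑ x ∈ S, ∑ y ∈ T, #{i : I | (i.1 : α) = x ∧ q i y} = #{i : I | (f i).isLeft} := by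
      simp only [hp]
      calc _ = ∑ x ∈ S, ∑ i : I, (if (i.1 : α) = x then 1 else 0) *
            (if (f i).isLeft then 1 else 0) :=
            Finset.sum_congr rfl fun x _ => by
              rw [Finset.sum_comm]
              simp only [← Finset.mul_sum, hq]
        _ = _ := by
            rw [Finset.sum_comm]
            simp only [← Finset.sum_mul, hS, one_mul]
            rw [Finset.card_filter]
    have hI : ∑ x ∈ S, u x = Fintype.card I := by
      rw [Fintype.card_sigma]
      simp only [Fintype.card_fin]
      exact (Finset.sum_coe_sort S u).symm
    have hright : #{i : I | ¬ (f i).isLeft} ≤ d := by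
      calc #{i : I | ¬ (f i).isLeft} = #(Finset.image f {i : I | ¬ (f i).isLeft}) :=
            (Finset.card_image_of_injective _ hf).symm
        _ ≤ #(Finset.univ.image fun k : Fin d => (Sum.inr k : J)) := by
            refine Finset.card_le_card ?_
            intro j hj
            obtain ⟨i, hi, rfl⟩ := Finset.mem_image.1 hj
            have hi := (Finset.mem_filter.1 hi).2
            rcases hfi : f i with j | k
            · simp [hfi] at hi
            · exact Finset.mem_image_of_mem _ (Finset.mem_univ k)
        _ ≤ d := Finset.card_image_le.trans (by simp)
    rw [htot, hI, ← Finset.card_univ, ← Finset.card_filter_add_card_filter_not (fun i => (f i).isLeft)]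
    exact Nat.add_le_add_left hright _

open Finset in
/-- A weighted form of Hall's marriage theorem with a deficiency. -/
theorem exists_transport {α β : Type*} (S : Finset α) (T : Finset β) (R : α → β → Prop)
    [DecidableRel R] (u : α → ℝ≥0) (v : β → ℝ≥0) (d : ℝ≥0) {η : ℝ≥0} (hη : 0 < η)
    (h : ∀ A ⊆ S, ∑ x ∈ A, u x ≤ ∑ y ∈ T with ∃ x ∈ A, R x y, v y + d) :
    ∃ p : α → β → ℝ≥0, (∀ x y, p x y ≠ 0 → R x y) ∧ (∀ x ∈ S, ∑ y ∈ T, p x y ≤ u x) ∧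
      (∀ y ∈ T, ∑ x ∈ S, p x y ≤ v y) ∧
      ∑ x ∈ S, u x ≤ ∑ x ∈ S, ∑ y ∈ T, p x y + d + η := by
  classical
  -- Weights are multiplied by `N` and rounded. Rounding costs at most `#S` for `u`, `#T` for `v`
  -- and 1 for `d`, which is at most `η` after division by `N`.
  obtain ⟨N, hN⟩ := exists_nat_gt ((#S + #T + 1 : ℝ≥0) / η)
  have hN0 : (0 : ℝ≥0) < N := (zero_le).trans_lt hN
  have hNη : (#S + #T + 1 : ℝ≥0) ≤ N * η := ((div_lt_iff₀ hη).1 hN).le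
  obtain ⟨p, hpR, hpu, hpv, hpt⟩ := exists_nat_transport S T R (fun x => ⌊N * u x⌋₊)
    (fun y => ⌊N * v y⌋₊) (⌈N * d⌉₊ + #T) (by
      intro A hA
      set B := {y ∈ T | ∃ x ∈ A, R x y}
      have : ((∑ x ∈ A, ⌊N * u x⌋₊ : ℕ) : ℝ≥0) ≤
          ((∑ y ∈ B, ⌊N * v y⌋₊ + (⌈N * d⌉₊ + #T) : ℕ) : ℝ≥0) := by
        push_cast
        calc ∑ x ∈ A, (⌊N * u x⌋₊ : ℝ≥0) ≤ ∑ x ∈ A, N * u x :=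
              Finset.sum_le_sum fun x _ => Nat.floor_le (zero_le)
          _ = N * ∑ x ∈ A, u x := by rw [Finset.mul_sum]
          _ ≤ N * (∑ y ∈ B, v y + d) := by gcongr; exact h A hA
          _ = ∑ y ∈ B, N * v y + N * d := by rw [mul_add, Finset.mul_sum]
          _ ≤ ∑ y ∈ B, ((⌊N * v y⌋₊ : ℝ≥0) + 1) + ⌈N * d⌉₊ := by
              gcongr with y
              · exact (Nat.lt_floor_add_one _).le
              · exact Nat.le_ceil _
          _ = ∑ y ∈ B, (⌊N * v y⌋₊ : ℝ≥0) + (⌈N * d⌉₊ + #B) := by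
              rw [Finset.sum_add_distrib]
              simp only [Finset.sum_const, nsmul_eq_mul, mul_one]
              ring
          _ ≤ _ := by
              gcongr
              exact Finset.filter_subset _ _
      exact_mod_cast this)
  refine ⟨fun x y => p x y / N, fun x y hxy => hpR x y ?_, fun x hx => ?_, fun y hy => ?_, ?_⟩
  · rintro h0
    simp [h0] at hxy
  · rw [← Finset.sum_div, div_le_iff₀ hN0, mul_comm]
    calc ∑ y ∈ T, (p x y : ℝ≥0) ≤ ⌊N * u x⌋₊ := by exact_mod_cast hpu x hx
      _ ≤ N * u x := Nat.floor_le (zero_le)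
  · rw [← Finset.sum_div, div_le_iff₀ hN0, mul_comm]
    calc ∑ x ∈ S, (p x y : ℝ≥0) ≤ ⌊N * v y⌋₊ := by exact_mod_cast hpv y hy
      _ ≤ N * v y := Nat.floor_le (zero_le)
  · simp only [← Finset.sum_div]
    refine le_of_mul_le_mul_left ?_ hN0
    rw [mul_add, mul_add, mul_div_cancel₀ _ hN0.ne']
    calc N * ∑ x ∈ S, u x = ∑ x ∈ S, N * u x := by rw [Finset.mul_sum]
      _ ≤ ∑ x ∈ S, ((⌊N * u x⌋₊ : ℝ≥0) + 1) := by
          gcongr; exact (Nat.lt_floor_add_one _).le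
      _ = ∑ x ∈ S, (⌊N * u x⌋₊ : ℝ≥0) + #S := by
          rw [Finset.sum_add_distrib]; simp
      _ ≤ (∑ x ∈ S, ∑ y ∈ T, (p x y : ℝ≥0) + (⌈N * d⌉₊ + #T)) + #S := by
          gcongr
          exact_mod_cast hpt
      _ ≤ (∑ x ∈ S, ∑ y ∈ T, (p x y : ℝ≥0) + (N * d + 1 + #T)) + #S := by
          gcongr
          exact (Nat.ceil_lt_add_one (zero_le)).le
      _ = ∑ x ∈ S, ∑ y ∈ T, (p x y : ℝ≥0) + N * d + (#S + #T + 1) := by ring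
      _ ≤ _ := by gcongr

/-! ### Cutting sets of reals into prescribed measures -/

/-- A measurable set of reals has subsets of all smaller measures. -/
theorem Real.exists_subset_volume_eq {A : Set ℝ} (hA : MeasurableSet A) (w : ℝ≥0)
    (hw : (w : ℝ≥0∞) ≤ volume A) : ∃ B ⊆ A, MeasurableSet B ∧ volume B = w := by
  rcases hw.eq_or_lt with hw | hw
  · exact ⟨A, subset_rfl, hA, hw.symm⟩
  -- `A` may have infinite measure; a bounded window makes the distribution function `f` real-valued
  -- and 1-Lipschitz, so that it takes the value `w`.
  obtain ⟨n, hn⟩ : ∃ n : ℕ, (w : ℝ≥0∞) < volume (A ∩ Icc (-n : ℝ) n) := by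
    have hmono : Monotone fun n : ℕ => A ∩ Icc (-n : ℝ) n := fun m n hmn =>
      inter_subset_inter_right _ (Icc_subset_Icc (by simpa using hmn) (by simpa using hmn))
    have hun : ⋃ n : ℕ, A ∩ Icc (-n : ℝ) n = A := by
      rw [← inter_iUnion]
      refine inter_eq_left.2 fun x _ => ?_
      obtain ⟨n, hn⟩ := exists_nat_ge |x|
      exact mem_iUnion.2 ⟨n, abs_le.1 hn⟩
    have := tendsto_measure_iUnion_atTop (μ := volume) hmono
    rw [hun] at this
    exact (this.eventually (lt_mem_nhds hw)).exists
  let f : ℝ → ℝ := fun t => volume.real (A ∩ Icc (-n : ℝ) t)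
  have hfin : ∀ t, volume (A ∩ Icc (-n : ℝ) t) ≠ ∞ := fun t =>
    ((measure_mono inter_subset_right).trans_lt measure_Icc_lt_top).ne
  have hf : LipschitzWith 1 f := by
    refine LipschitzWith.of_le_add fun s t => ?_
    have hsub : A ∩ Icc (-n : ℝ) s ⊆ (A ∩ Icc (-n : ℝ) t) ∪ Icc t s := by
      rintro x ⟨hxA, h1, h2⟩
      rcases le_total x t with h | h
      exacts [.inl ⟨hxA, h1, h⟩, .inr ⟨h, h2⟩]
    calc f s ≤ volume.real ((A ∩ Icc (-n : ℝ) t) ∪ Icc t s) :=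
          measureReal_mono hsub (measure_union_ne_top (hfin t) measure_Icc_lt_top.ne)
      _ ≤ f t + volume.real (Icc t s) := measureReal_union_le _ _
      _ ≤ f t + dist s t := by
          gcongr
          rw [Real.volume_real_Icc, Real.dist_eq]
          exact max_le (le_abs_self _) (abs_nonneg _)
  have h0 : f (-n) = 0 := by
    have : volume (A ∩ Icc (-n : ℝ) (-n)) = 0 :=
      measure_mono_null inter_subset_right (by simp)
    simp only [f, Measure.real, this, ENNReal.toReal_zero]
  obtain ⟨t, -, ht⟩ := intermediate_value_Icc (a := (-n : ℝ)) (b := n)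
    (by linarith [n.cast_nonneg (α := ℝ)]) hf.continuous.continuousOn
    (show (w : ℝ) ∈ Icc (f (-n)) (f n) from ⟨h0 ▸ w.2, by
      have := ENNReal.toReal_mono (hfin n) hn.le
      rw [ENNReal.coe_toReal] at this
      exact this⟩)
  refine ⟨A ∩ Icc (-n : ℝ) t, inter_subset_left, hA.inter measurableSet_Icc, ?_⟩
  rw [← ENNReal.ofReal_toReal (hfin t)]
  change ENNReal.ofReal (f t) = w
  rw [ht, ENNReal.ofReal_coe_nnreal]

open Finset in
/-- A measurable set of reals has disjoint subsets of prescribed measures. -/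
theorem Real.exists_disjoint_subsets_volume_eq {β : Type*} (T : Finset β) (w : β → ℝ≥0)
    {A : Set ℝ} (hA : MeasurableSet A) (hw : ((∑ y ∈ T, w y : ℝ≥0) : ℝ≥0∞) ≤ volume A) :
    ∃ B : β → Set ℝ, (∀ y, MeasurableSet (B y)) ∧ (∀ y, B y ⊆ A) ∧
      (∀ y z, y ≠ z → Disjoint (B y) (B z)) ∧ (∀ y ∈ T, volume (B y) = w y) ∧
      ∀ y ∉ T, B y = ∅ := by
  classical
  induction T using Finset.induction_on generalizing A with
  | empty => exact ⟨fun _ => ∅, by simp⟩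
  | insert z T hz ih =>
    rw [Finset.sum_insert hz] at hw
    obtain ⟨C, hCA, hC, hCw⟩ := Real.exists_subset_volume_eq hA (w z)
      (le_trans (by push_cast; exact le_self_add) hw)
    obtain ⟨B, hB, hBA, hBd, hBw, hBe⟩ := ih (hA.diff hC) (by
      rw [measure_sdiff hCA hC.nullMeasurableSet (by rw [hCw]; exact ENNReal.coe_ne_top), hCw]
      refine ENNReal.le_sub_of_add_le_left ENNReal.coe_ne_top ?_
      exact_mod_cast hw)
    have hd : ∀ y, Disjoint C (B y) := fun y =>
      disjoint_sdiff_right.mono_right (hBA y)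
    refine ⟨fun y => if y = z then C else B y, fun y => ?_, fun y => ?_, fun y y' hy => ?_,
      fun y hy => ?_, fun y hy => ?_⟩
    · dsimp only; split_ifs
      exacts [hC, hB y]
    · dsimp only; split_ifs
      exacts [hCA, (hBA y).trans sdiff_subset]
    · dsimp only; split_ifs with h1 h2 h2
      · exact absurd (h1.trans h2.symm) hy
      · exact hd y'
      · exact (hd y).symm
      · exact hBd y y' hy
    · dsimp only; split_ifs with h1
      · rw [h1, hCw]
      · exact hBw y ((Finset.mem_insert.1 hy).resolve_left h1)
    · rw [Finset.mem_insert, not_or] at hy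
      simp only [hy.1, if_false]
      exact hBe y hy.2

theorem MeasureTheory.SimpleFunc.exists_eq_on_of_disjoint {α β : Type*} [MeasurableSpace α]
    [Nonempty β] (T : Finset β) {Q : β → Set α} (hQ : ∀ y, MeasurableSet (Q y))
    (hd : ∀ y z, y ≠ z → Disjoint (Q y) (Q z)) :
    ∃ ψ : SimpleFunc α β, ∀ y ∈ T, ∀ t ∈ Q y, ψ t = y := by
  classical
  induction T using Finset.induction_on with
  | empty => exact ⟨SimpleFunc.const _ (Classical.arbitrary β), by simp⟩
  | insert z T hz ih =>
    obtain ⟨ψ, hψ⟩ := ih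
    refine ⟨SimpleFunc.piecewise (Q z) (hQ z) (SimpleFunc.const _ z) ψ, fun y hy t ht => ?_⟩
    by_cases hyz : y = z
    · subst hyz
      simp [ht]
    · have : t ∉ Q z := fun h => disjoint_left.1 (hd y z hyz) ht h
      simp only [SimpleFunc.coe_piecewise, Set.piecewise_eq_of_notMem _ _ _ this]
      exact hψ y ((Finset.mem_insert.1 hy).resolve_left hyz) t ht

/-! ### Couplings of finitely supported measures -/

theorem DistMeasSpace.measure_eq_sum (X : DistMeasSpace.{u}) {S : Finset X}
    (hS : X.μ (Sᶜ : Set X) = 0) (A : Set X) [DecidablePred (· ∈ A)] :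
    X.μ A = ∑ x ∈ S with x ∈ A, X.μ {x} := by
  rw [sum_measure_singleton, Finset.coe_filter]
  refine le_antisymm ?_ (measure_mono fun x hx => hx.2)
  calc X.μ A ≤ X.μ ({x | x ∈ S ∧ x ∈ A} ∪ (Sᶜ : Set X)) := measure_mono fun x hx => by
        by_cases h : x ∈ S
        exacts [.inl ⟨h, hx⟩, .inr h]
    _ ≤ _ := (measure_union_le _ _).trans (by rw [hS, add_zero])

/-- If the images of `y` and `y'` are at distance at least `L`, so are `y` and `y'`, and the bound
is trivial. Otherwise their images are no farther apart than they are, and the triangle inequality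
in `Z` applies. -/
theorem min_le_add_of_edist_lt {U V Z : Type*} [EMetricSpace U] [EMetricSpace V] [EMetricSpace Z]
    {L a : ℝ≥0∞} {f : U → Z} {g : V → Z} {x x' : U} {y y' : V}
    (hf : min L (edist (f x) (f x')) = min L (edist x x'))
    (hg : min L (edist (g y) (g y')) = min L (edist y y'))
    (h : edist (f x) (g y) < a) (h' : edist (f x') (g y') < a) :
    min L (edist x x') ≤ edist y y' + 2 * a := by
  have h1 : edist (f x) (f x') ≤ edist (g y) (g y') + 2 * a :=
    calc edist (f x) (f x') ≤ edist (f x) (g y) + edist (g y) (g y') + edist (g y') (f x') :=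
          edist_triangle4 ..
      _ ≤ a + edist (g y) (g y') + a := by
          rw [edist_comm (g y')]
          gcongr
      _ = _ := by ring
  rcases le_total L (edist (g y) (g y')) with h2 | h2
  · rw [min_eq_left h2] at hg
    exact (min_le_left _ _).trans ((hg.le.trans (min_le_right _ _)).trans le_self_add)
  · rw [min_eq_right h2] at hg
    rw [← hf]
    refine (min_le_right _ _).trans (h1.trans ?_)
    gcongr
    exact hg.le.trans (min_le_right _ _)

/-- Two close spaces with finitely supported measures have a partial coupling supported on a
relation which almost preserves the truncated distances. -/
theorem RhoClose.exists_finite_coupling {a : ℝ≥0} (ha : 0 < a) {X Y : DistMeasSpace.{u}}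
    (h : RhoClose a X Y) {S : Finset X} {T : Finset Y} (hS : X.μ (Sᶜ : Set X) = 0)
    (hT : Y.μ (Tᶜ : Set Y) = 0) :
    ∃ (R : X → Y → Prop) (p : X → Y → ℝ≥0),
      (∀ x x' y y', R x y → R x' y' →
        min (a : ℝ≥0∞)⁻¹ (edist x x') ≤ edist y y' + 2 * a ∧
        min (a : ℝ≥0∞)⁻¹ (edist y y') ≤ edist x x' + 2 * a) ∧
      (∀ x y, p x y ≠ 0 → R x y) ∧ (∀ x ∈ S, ∑ y ∈ T, (p x y : ℝ≥0∞) ≤ X.μ {x}) ∧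
      (∀ y ∈ T, ∑ x ∈ S, (p x y : ℝ≥0∞) ≤ Y.μ {y}) ∧
      X.μ univ ≤ ∑ x ∈ S, ∑ y ∈ T, (p x y : ℝ≥0∞) + 5 * a ∧
      Y.μ univ ≤ ∑ x ∈ S, ∑ y ∈ T, (p x y : ℝ≥0∞) + 5 * a := by
  classical
  obtain ⟨Z, _, _, _, f, g, hf, hg, ⟨E, hE, hEa, hEi⟩, ⟨F, hF, hFa, hFi⟩, h1, h2⟩ := h
  let R : X → Y → Prop := fun x y => x ∉ E ∧ y ∉ F ∧ edist (f x) (g y) < a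
  have hu : ∀ x, (((X.μ {x}).toNNReal : ℝ≥0) : ℝ≥0∞) = X.μ {x} := fun x =>
    ENNReal.coe_toNNReal (measure_ne_top _ _)
  have hv : ∀ x, (((Y.μ {x}).toNNReal : ℝ≥0) : ℝ≥0∞) = Y.μ {x} := fun x =>
    ENNReal.coe_toNNReal (measure_ne_top _ _)
  -- Hall's condition is the Lévy-Prokhorov inequality for the finite set `f '' (A \ E)`. The
  -- deficiency `3 * a` accounts for `E`, `F` and that inequality; rounding adds `a`, and the
  -- comparison of total masses another `a` for `Y`.
  obtain ⟨p, hpR, hpX, hpY, hpt⟩ := exists_transport S T R (fun x => (X.μ {x}).toNNReal)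
    (fun y => (Y.μ {y}).toNNReal) (3 * a) ha (by
      intro A hA
      rw [← ENNReal.coe_le_coe]
      push_cast
      simp only [hu, hv]
      rw [sum_measure_singleton]
      let C : Set Z := f '' (A \ E)
      have hC : MeasurableSet C := ((A.finite_toSet.subset sdiff_subset).image f).measurableSet
      calc X.μ A ≤ X.μ (f ⁻¹' C) + X.μ E := by
            refine (measure_mono fun x hx => ?_).trans (measure_union_le _ _)
            by_cases hxE : x ∈ E
            exacts [.inr hxE, .inl ⟨x, ⟨hx, hxE⟩, rfl⟩]
        _ ≤ Y.μ (g ⁻¹' Metric.thickening a C) + a + a := by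
            gcongr
            exact h1 C hC
        _ ≤ Y.μ {y | ∃ x ∈ A, R x y} + Y.μ F + a + a := by
            gcongr
            refine (measure_mono fun y hy => ?_).trans (measure_union_le _ _)
            by_cases hyF : y ∈ F
            · exact .inr hyF
            obtain ⟨_, ⟨x, ⟨hx, hxE⟩, rfl⟩, hxy⟩ := exists_edist_lt_of_mem_thickening.1 hy
            rw [edist_comm] at hxy
            exact .inl ⟨x, hx, hxE, hyF, hxy⟩
        _ ≤ Y.μ {y | ∃ x ∈ A, R x y} + a + a + a := by gcongr
        _ = _ := by
            rw [Y.measure_eq_sum hT]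
            simp only [mem_ofPred_eq]
            ring)
  have hXt : X.μ univ ≤ ∑ x ∈ S, ∑ y ∈ T, (p x y : ℝ≥0∞) + 4 * a := by
    rw [X.measure_eq_sum hS univ]
    simp only [mem_univ, Finset.filter_true]
    calc ∑ x ∈ S, X.μ {x} = ((∑ x ∈ S, (X.μ {x}).toNNReal : ℝ≥0) : ℝ≥0∞) := by
          push_cast; simp only [hu]
      _ ≤ ((∑ x ∈ S, ∑ y ∈ T, p x y + 3 * a + a : ℝ≥0) : ℝ≥0∞) := ENNReal.coe_le_coe.2 hpt
      _ = _ := by push_cast; ring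
  refine ⟨R, p, ?_, hpR, fun x hx => ?_, fun y hy => ?_, hXt.trans ?_, ?_⟩
  · rintro x x' y y' ⟨hx, hy, hxy⟩ ⟨hx', hy', hxy'⟩
    refine ⟨min_le_add_of_edist_lt (hEi x hx x' hx') (hFi y hy y' hy') hxy hxy',
      min_le_add_of_edist_lt (hFi y hy y' hy') (hEi x hx x' hx') ?_ ?_⟩
    · rwa [edist_comm]
    · rwa [edist_comm]
  · rw [← hu]
    exact_mod_cast hpX x hx
  · rw [← hv]
    exact_mod_cast hpY y hy
  · gcongr
    norm_num
  · calc Y.μ univ ≤ X.μ univ + a := by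
          have := h2 univ .univ
          rw [preimage_univ] at this
          exact this.trans (by gcongr; exact subset_univ _)
      _ ≤ ∑ x ∈ S, ∑ y ∈ T, (p x y : ℝ≥0∞) + 4 * a + a := by gcongr
      _ = _ := by ring

/-! ### Parametrizations by sets of reals -/

/-- A simple function defined on a set of reals and whose law is the measure of `X`. -/
structure DistMeasSpace.Param (X : DistMeasSpace.{u}) where
  map : SimpleFunc ℝ X
  dom : Set ℝ
  measurableSet_dom : MeasurableSet dom
  volume_inter : ∀ A, MeasurableSet A → volume (dom ∩ map ⁻¹' A) = X.μ A

theorem DistMeasSpace.Param.volume_dom {X : DistMeasSpace.{u}} (q : X.Param) :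
    volume q.dom = X.μ univ := by
  rw [← q.volume_inter univ .univ, preimage_univ, inter_univ]

/-- Disjoint sets with the right measures define a parametrization. -/
theorem DistMeasSpace.Param.exists_of_disjoint {Y : DistMeasSpace.{u}} [Nonempty Y] {T : Finset Y}
    (hT : Y.μ (Tᶜ : Set Y) = 0) {Q : Y → Set ℝ} (hQ : ∀ y, MeasurableSet (Q y))
    (hd : ∀ y z, y ≠ z → Disjoint (Q y) (Q z)) (hv : ∀ y ∈ T, volume (Q y) = Y.μ {y}) :
    ∃ q : Y.Param, q.dom = ⋃ y ∈ T, Q y ∧ ∀ y ∈ T, ∀ t ∈ Q y, q.map t = y := by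
  classical
  obtain ⟨ψ, hψ⟩ := SimpleFunc.exists_eq_on_of_disjoint T hQ hd
  refine ⟨⟨ψ, ⋃ y ∈ T, Q y, T.measurableSet_biUnion fun y _ => hQ y, fun A hA => ?_⟩, rfl, hψ⟩
  have : (⋃ y ∈ T, Q y) ∩ ψ ⁻¹' A = ⋃ y ∈ T.filter (· ∈ A), Q y := by
    ext t
    simp only [mem_inter_iff, mem_iUnion, mem_preimage, Finset.mem_filter, exists_prop]
    constructor
    · rintro ⟨⟨y, hy, ht⟩, htA⟩
      rw [hψ y hy t ht] at htA
      exact ⟨y, ⟨hy, htA⟩, ht⟩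
    · rintro ⟨y, ⟨hy, hyA⟩, ht⟩
      exact ⟨⟨y, hy, ht⟩, by rwa [hψ y hy t ht]⟩
  rw [this, measure_biUnion_finset (fun y _ z _ h => hd y z h) fun y _ => hQ y,
    Y.measure_eq_sum hT A]
  exact Finset.sum_congr rfl fun y hy => hv y (Finset.mem_filter.1 hy).1

theorem DistMeasSpace.IsFinitary.exists_param {Y : DistMeasSpace.{u}} (hY : Y.IsFinitary) :
    Nonempty Y.Param := by
  obtain ⟨hne, T, hT⟩ := hY
  obtain ⟨B, hB, -, hd, hv, -⟩ := Real.exists_disjoint_subsets_volume_eq T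
    (fun y => (Y.μ {y}).toNNReal) (A := univ) .univ (by simp)
  obtain ⟨q, -⟩ := DistMeasSpace.Param.exists_of_disjoint hT hB hd fun y hy => by
    rw [hv y hy, ENNReal.coe_toNNReal (measure_ne_top _ _)]
  exact ⟨q⟩

/-- The fibre of `φ` over `x` is cut into pieces of measure `p x y`, on which `ψ` takes the value
`y`; the uncoupled mass of `Y` is put outside `φ.dom`, where there is infinite room. As `φ` is given
in advance, the construction can be iterated. -/
theorem RhoClose.exists_param {a : ℝ≥0} (ha : 0 < a) {X Y : DistMeasSpace.{u}}
    (hX : X.IsFinitary) (hY : Y.IsFinitary) (h : RhoClose a X Y) (φ : X.Param) :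
    ∃ (ψ : Y.Param) (H : Set ℝ), MeasurableSet H ∧ H ⊆ φ.dom ∧ H ⊆ ψ.dom ∧
      volume ((φ.dom ∪ ψ.dom) \ H) ≤ 10 * a ∧ ∀ s ∈ H, ∀ t ∈ H,
        min (a : ℝ≥0∞)⁻¹ (edist (φ.map s) (φ.map t)) ≤ edist (ψ.map s) (ψ.map t) + 2 * a ∧
        min (a : ℝ≥0∞)⁻¹ (edist (ψ.map s) (ψ.map t)) ≤ edist (φ.map s) (φ.map t) + 2 * a := by
  classical
  obtain ⟨-, S, hS⟩ := hX
  obtain ⟨hne, T, hT⟩ := hY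
  obtain ⟨R, p, hR, hpR, hpX, hpY, hXt, hYt⟩ := h.exists_finite_coupling ha hS hT
  have hfib : ∀ x, MeasurableSet (φ.dom ∩ φ.map ⁻¹' {x}) := fun x =>
    φ.measurableSet_dom.inter (φ.map.measurableSet_fiber x)
  have hfv : ∀ x, volume (φ.dom ∩ φ.map ⁻¹' {x}) = X.μ {x} := fun x =>
    φ.volume_inter _ (measurableSet_singleton x)
  have hsplit : ∀ x, ∃ B : Y → Set ℝ, (∀ y, MeasurableSet (B y)) ∧
      (∀ y, B y ⊆ φ.dom ∩ φ.map ⁻¹' {x}) ∧ (∀ y z, y ≠ z → Disjoint (B y) (B z)) ∧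
      (x ∈ S → ∀ y ∈ T, volume (B y) = p x y) ∧ ∀ y, p x y = 0 → B y = ∅ := by
    intro x
    by_cases hx : x ∈ S
    -- Pieces of weight zero must be empty and not merely null, so that `R` holds at every point of
    -- `H`.
    · obtain ⟨B, h1, h2, h3, h4, h5⟩ := Real.exists_disjoint_subsets_volume_eq
        (T.filter (p x · ≠ 0)) (p x) (hfib x) (by
          rw [hfv, Finset.sum_filter_ne_zero]
          exact_mod_cast hpX x hx)
      have h6 : ∀ y, p x y = 0 → B y = ∅ := fun y hy => h5 y fun hy' =>
        (Finset.mem_filter.1 hy').2 hy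
      refine ⟨B, h1, h2, h3, fun _ y hy => ?_, h6⟩
      by_cases hy0 : p x y = 0
      · simp [h6 y hy0, hy0]
      · exact h4 y (Finset.mem_filter.2 ⟨hy, hy0⟩)
    · exact ⟨fun _ => ∅, by simp [hx]⟩
  choose B hB hBφ hBd hBv hB0 using hsplit
  have hBd' : ∀ x x' y y', x ≠ x' → Disjoint (B x y) (B x' y') := by
    intro x x' y y' hxx
    refine disjoint_left.2 fun t ht ht' => hxx ?_
    exact (hBφ x y ht).2.symm.trans (hBφ x' y' ht').2
  let w : Y → ℝ≥0 := fun y => (Y.μ {y}).toNNReal - ∑ x ∈ S, p x y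
  have hw : ∀ y ∈ T, (∑ x ∈ S, (p x y : ℝ≥0∞)) + w y = Y.μ {y} := by
    intro y hy
    rw [← ENNReal.coe_toNNReal (measure_ne_top Y.μ {y})]
    norm_cast
    refine add_tsub_cancel_of_le ?_
    rw [← ENNReal.coe_le_coe, ENNReal.coe_toNNReal (measure_ne_top Y.μ {y})]
    exact_mod_cast hpY y hy
  obtain ⟨C, hC, hCφ, hCd, hCv, -⟩ := Real.exists_disjoint_subsets_volume_eq T w
    φ.measurableSet_dom.compl (by
      have : volume φ.domᶜ = ∞ := by
        rw [measure_compl φ.measurableSet_dom (by rw [φ.volume_dom]; exact measure_ne_top _ _),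
          Real.volume_univ, ENNReal.top_sub (by rw [φ.volume_dom]; exact measure_ne_top _ _)]
      rw [this]
      exact le_top)
  have hBC : ∀ x y z, Disjoint (B x y) (C z) := fun x y z =>
    disjoint_left.2 fun t ht ht' => hCφ z ht' (hBφ x y ht).1
  have hBU : ∀ y, MeasurableSet (⋃ x ∈ S, B x y) := fun y =>
    S.measurableSet_biUnion fun x _ => hB x y
  have hBUv : ∀ y ∈ T, volume (⋃ x ∈ S, B x y) = ∑ x ∈ S, (p x y : ℝ≥0∞) := fun y hy => by
    rw [measure_biUnion_finset (fun x _ x' _ h => hBd' x x' y y h) fun x _ => hB x y]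
    exact Finset.sum_congr rfl fun x hx => hBv x hx y hy
  have hBUd : ∀ y z, y ≠ z → Disjoint (⋃ x ∈ S, B x y) (⋃ x ∈ S, B x z) := by
    intro y z hyz
    simp only [disjoint_iUnion_left, disjoint_iUnion_right]
    intro x' _ x _
    by_cases hxx : x = x'
    · subst hxx
      exact hBd x y z hyz
    · exact hBd' _ _ _ _ hxx
  obtain ⟨ψ, hψd, hψ⟩ := DistMeasSpace.Param.exists_of_disjoint (Y := Y) hT
    (Q := fun y => (⋃ x ∈ S, B x y) ∪ C y) (fun y => (hBU y).union (hC y))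
    (fun y z hyz => by
      simp only [disjoint_union_left, disjoint_union_right]
      refine ⟨⟨hBUd y z hyz, ?_⟩, ?_, hCd y z hyz⟩
      · simp only [disjoint_iUnion_right]
        exact fun x _ => (hBC x z y).symm
      · simp only [disjoint_iUnion_left]
        exact fun x _ => hBC x y z)
    (fun y hy => by
      rw [measure_union (by
        simp only [disjoint_iUnion_left]
        exact fun x _ => hBC x y y) (hC y), hBUv y hy, hCv y hy, hw y hy])
  have hHv : volume (⋃ y ∈ T, ⋃ x ∈ S, B x y) = ∑ x ∈ S, ∑ y ∈ T, (p x y : ℝ≥0∞) := by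
    rw [measure_biUnion_finset (fun y _ z _ h => hBUd y z h) fun y _ => hBU y, Finset.sum_comm]
    exact Finset.sum_congr rfl fun y hy => hBUv y hy
  have hHm : MeasurableSet (⋃ y ∈ T, ⋃ x ∈ S, B x y) :=
    T.measurableSet_biUnion fun y _ => hBU y
  have hHφ : (⋃ y ∈ T, ⋃ x ∈ S, B x y) ⊆ φ.dom := by
    simp only [iUnion_subset_iff]
    exact fun y _ x _ => (hBφ x y).trans inter_subset_left
  have hHψ : (⋃ y ∈ T, ⋃ x ∈ S, B x y) ⊆ ψ.dom := by
    rw [hψd]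
    exact iUnion₂_mono fun y _ => subset_union_left
  have hHfin : volume (⋃ y ∈ T, ⋃ x ∈ S, B x y) ≠ ∞ :=
    ((measure_mono hHφ).trans_lt (by rw [φ.volume_dom]; exact measure_lt_top _ _)).ne
  refine ⟨ψ, ⋃ y ∈ T, ⋃ x ∈ S, B x y, hHm, hHφ, hHψ, ?_, ?_⟩
  · rw [union_sdiff_distrib]
    calc _ ≤ volume (φ.dom \ ⋃ y ∈ T, ⋃ x ∈ S, B x y) +
          volume (ψ.dom \ ⋃ y ∈ T, ⋃ x ∈ S, B x y) := measure_union_le _ _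
      _ ≤ 5 * a + 5 * a := by
          rw [measure_sdiff hHφ hHm.nullMeasurableSet hHfin,
            measure_sdiff hHψ hHm.nullMeasurableSet hHfin, φ.volume_dom, ψ.volume_dom, hHv]
          gcongr
          · exact tsub_le_iff_left.2 hXt
          · exact tsub_le_iff_left.2 hYt
      _ = 10 * a := by ring
  · have key : ∀ t ∈ ⋃ y ∈ T, ⋃ x ∈ S, B x y, R (φ.map t) (ψ.map t) := by
      intro t ht
      simp only [mem_iUnion] at ht
      obtain ⟨y, hy, x, hx, ht⟩ := ht
      have h1 : φ.map t = x := (hBφ x y ht).2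
      have h2 : ψ.map t = y := hψ y hy t (.inl (mem_biUnion hx ht))
      rw [h1, h2]
      refine hpR x y fun h0 => ?_
      rw [hB0 x y h0] at ht
      exact ht
    exact fun s hs t ht => hR _ _ _ _ (key s hs) (key t ht)

/-! ### Kuratowski realisation of a pseudo-distance -/

theorem ENNReal.edist_toReal_le {s t c : ℝ≥0∞} (hs : s ≠ ∞) (ht : t ≠ ∞) (h : s ≤ t + c)
    (h' : t ≤ s + c) : edist s.toReal t.toReal ≤ c := by
  rcases eq_or_ne c ∞ with rfl | hc
  · exact le_top
  lift s to ℝ≥0 using hs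
  lift t to ℝ≥0 using ht
  lift c to ℝ≥0 using hc
  norm_cast at h h'
  rw [edist_dist, Real.dist_eq]
  refine ENNReal.ofReal_le_of_le_toReal ?_
  have h1 : (s : ℝ) ≤ t + c := by exact_mod_cast h
  have h2 : (t : ℝ) ≤ s + c := by exact_mod_cast h'
  simp only [ENNReal.coe_toReal]
  exact abs_sub_le_iff.2 ⟨by linarith, by linarith⟩

section Kuratowski

variable {T : Type} (d : T → T → ℝ≥0∞)

/-- The truncated distances to all the points, as a function with real values. -/
noncomputable def kuratowskiTrunc (x : T) : UniformFun (ULift.{u} (T × ℕ)) ℝ :=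
  UniformFun.ofFun fun i => (min (d x i.down.1) i.down.2).toReal

/-- Each coordinate is 1-Lipschitz, and the coordinate `(y, n)` separates `x` from `y` by exactly
`min (d x y) n`. The supremum over `n` recovers `d x y` even when it is infinite. -/
theorem edist_kuratowskiTrunc (h0 : ∀ x, d x x = 0) (hc : ∀ x y, d x y = d y x)
    (ht : ∀ x y z, d x z ≤ d x y + d y z) (x y : T) :
    edist (kuratowskiTrunc.{u} d x) (kuratowskiTrunc.{u} d y) = d x y := by
  have hfin : ∀ (s : ℝ≥0∞) (n : ℕ), min s n ≠ ∞ := fun s n =>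
    ne_top_of_le_ne_top (ENNReal.natCast_ne_top n) (min_le_right _ _)
  have hmin : ∀ (s t c : ℝ≥0∞) (n : ℕ), s ≤ t + c → min s n ≤ min t n + c := by
    intro s t c n h
    rcases le_total t n with h' | h'
    · rw [min_eq_left h']; exact (min_le_left _ _).trans h
    · rw [min_eq_right h']; exact (min_le_right _ _).trans le_self_add
  rw [UniformFun.edist_def]
  refine le_antisymm (iSup_le fun i => ENNReal.edist_toReal_le (hfin _ _) (hfin _ _)
    (hmin _ _ _ _ ?_) (hmin _ _ _ _ ?_)) (le_of_forall_lt fun c hcd => ?_)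
  · rw [add_comm]; exact ht _ _ _
  · rw [add_comm, hc x y]; exact ht _ _ _
  · obtain ⟨n, hn⟩ := ENNReal.exists_nat_gt (ne_top_of_lt hcd)
    refine (lt_min hcd hn).trans_le (le_trans ?_ (le_iSup _ ⟨(y, n)⟩))
    change min (d x y) n ≤ edist (min (d x y) n).toReal (min (d y y) n).toReal
    rw [h0, min_eq_left zero_le, ENNReal.toReal_zero, edist_dist, Real.dist_eq, sub_zero,
      abs_of_nonneg ENNReal.toReal_nonneg, ENNReal.ofReal_toReal (hfin _ _)]

/-- A finite measure on a separable measurable pseudo-distance space has an image on a complete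
separable distance measure space. -/
theorem DistMeasSpace.exists_of_pseudoDist [MeasurableSpace T] (P : Measure T) [IsFiniteMeasure P]
    (h0 : ∀ x, d x x = 0) (hc : ∀ x y, d x y = d y x) (ht : ∀ x y z, d x z ≤ d x y + d y z)
    (hm : ∀ x, Measurable (d x)) {S : Set T} (hS : S.Countable)
    (hd : ∀ x, ∀ ε > 0, ∃ s ∈ S, d s x < ε) :
    ∃ (X : DistMeasSpace.{u}) (π : T → X), Measurable π ∧ (∀ x y, edist (π x) (π y) = d x y) ∧
      X.μ = P.map π := by
  have hK := edist_kuratowskiTrunc.{u} d h0 hc ht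
  let C : Set (UniformFun (ULift.{u} (T × ℕ)) ℝ) := closure (range (kuratowskiTrunc.{u} d))
  let π : T → C := fun x => ⟨kuratowskiTrunc d x, subset_closure ⟨x, rfl⟩⟩
  have hπ : ∀ x y, edist (π x) (π y) = d x y := hK
  have hCc : CompleteSpace C := isClosed_closure.completeSpace_coe
  have hdense : ∀ c : C, ∀ ε > 0, ∃ s ∈ S, edist (π s) c < ε := by
    intro c ε hε
    obtain ⟨_, ⟨x, rfl⟩, hx⟩ := EMetric.mem_closure_iff.1 c.2 (ε / 2) (ENNReal.half_pos hε.ne')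
    obtain ⟨s, hs, hsx⟩ := hd x (ε / 2) (ENNReal.half_pos hε.ne')
    refine ⟨s, hs, ?_⟩
    calc edist (π s) c ≤ edist (π s) (π x) + edist (π x) c := edist_triangle ..
      _ < ε / 2 + ε / 2 := ENNReal.add_lt_add (by rwa [hπ]) (by rw [edist_comm]; exact hx)
      _ = ε := ENNReal.add_halves ε
  have hsep : TopologicalSpace.SeparableSpace C := by
    refine ⟨π '' S, hS.image π, fun c => EMetric.mem_closure_iff.2 fun ε hε => ?_⟩
    obtain ⟨s, hs, hsc⟩ := hdense c ε hε
    exact ⟨π s, mem_image_of_mem _ hs, by rwa [edist_comm]⟩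
  have hsec : SecondCountableTopology C := UniformSpace.secondCountable_of_separable C
  let _ : MeasurableSpace C := _root_.borel C
  have _ : BorelSpace C := ⟨rfl⟩
  have hπm : Measurable π := by
    refine measurable_of_isOpen fun U hU => ?_
    -- No topology on `T` is given: open sets are countable unions of balls around `π '' S`, whose
    -- preimages are measurable by `hm`.
    have hU' : π ⁻¹' U = ⋃ s ∈ S, ⋃ n ∈ {n : ℕ | Metric.eball (π s) (n : ℝ≥0∞)⁻¹ ⊆ U},
        {x | d s x < (n : ℝ≥0∞)⁻¹} := by
      ext x
      simp only [mem_preimage, mem_iUnion, mem_ofPred_eq, exists_prop]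
      constructor
      · intro hx
        obtain ⟨ε, hε, hεU⟩ := EMetric.isOpen_iff.1 hU _ hx
        obtain ⟨n, hn⟩ := ENNReal.exists_inv_nat_lt (ENNReal.half_pos hε.ne').ne'
        obtain ⟨s, hs, hsx⟩ := hd x (n : ℝ≥0∞)⁻¹ (by simp)
        refine ⟨s, hs, n, fun c hcs => hεU ?_, hsx⟩
        calc edist c (π x) ≤ edist c (π s) + edist (π s) (π x) := edist_triangle ..
          _ < ε / 2 + ε / 2 := ENNReal.add_lt_add (lt_trans hcs hn) (by
              rw [hπ]; exact hsx.trans hn)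
          _ = ε := ENNReal.add_halves ε
      · rintro ⟨s, hs, n, hn, hsx⟩
        refine hn ?_
        rw [Metric.mem_eball, edist_comm, hπ]
        exact hsx
    rw [hU']
    exact MeasurableSet.biUnion hS fun s _ => MeasurableSet.biUnion (to_countable _) fun n _ =>
      measurableSet_lt (hm s) measurable_const
  exact ⟨{ carrier := C, μ := P.map π }, π, hπm, hπ, rfl⟩

end Kuratowski

/-! ### Chains of approximate inequalities -/

section Sequences

open Filter

theorem ENNReal.limsup_le_limsup_add_limsup {u v w : ℕ → ℝ≥0∞} (h : ∀ n, u n ≤ v n + w n) :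
    limsup u atTop ≤ limsup v atTop + limsup w atTop := by
  refine ENNReal.le_of_forall_pos_le_add fun ε hε hlt => ?_
  have hε' : (ε / 2 : ℝ≥0∞) ≠ 0 := (ENNReal.half_pos (by exact_mod_cast hε.ne')).ne'
  have hv := eventually_lt_of_limsup_lt (ENNReal.lt_add_right
    (ne_top_of_le_ne_top hlt.ne (le_self_add : limsup v atTop ≤ _)) hε')
  have hw := eventually_lt_of_limsup_lt (ENNReal.lt_add_right
    (ne_top_of_le_ne_top hlt.ne (le_add_self : limsup w atTop ≤ _)) hε')
  refine limsup_le_of_le ?_ ?_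
  · isBoundedDefault
  filter_upwards [hv, hw] with n h1 h2
  calc u n ≤ v n + w n := h n
    _ ≤ (limsup v atTop + ε / 2) + (limsup w atTop + ε / 2) := by gcongr
    _ = limsup v atTop + limsup w atTop + (ε / 2 + ε / 2) := by ring
    _ = _ := by rw [ENNReal.add_halves]

variable {a : ℕ → ℝ≥0} {e : ℕ → ℝ≥0∞} {k : ℕ}

/-- The errors telescope, as `2 * a n = 4 * a n - 4 * a (n + 1)`. Truncation levels increase with
the index, so a distance cut off at a later level already exceeds the earlier one. -/
theorem min_le_add_of_chain (ha : ∀ n, a n = 2 * a (n + 1))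
    (h : ∀ n ≥ k, min (a n : ℝ≥0∞)⁻¹ (e n) ≤ e (n + 1) + 2 * a n) {n m : ℕ} (hn : k ≤ n)
    (hnm : n ≤ m) : min (a n : ℝ≥0∞)⁻¹ (e n) + 4 * a m ≤ e m + 4 * a n := by
  have hanti : Antitone a := antitone_nat_of_succ_le fun n => by
    rw [ha n]; exact le_mul_of_one_le_left zero_le one_le_two
  have hai : ∀ n, 4 * (a n : ℝ≥0∞) = 4 * a (n + 1) + 2 * a n := fun n => by
    rw [ha n]; push_cast; ring
  induction m, hnm using Nat.le_induction with
  | base => gcongr; exact min_le_right _ _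
  | succ m hnm ih =>
    have hm := h m (hn.trans hnm)
    have h4 : 4 * (a m : ℝ≥0∞) ≤ 4 * a n := by gcongr; exact hanti hnm
    rcases le_total (a m : ℝ≥0∞)⁻¹ (e m) with h' | h'
    · rw [min_eq_left h'] at hm
      have : (a n : ℝ≥0∞)⁻¹ ≤ (a m : ℝ≥0∞)⁻¹ := by
        gcongr; exact hanti hnm
      calc min (a n : ℝ≥0∞)⁻¹ (e n) + 4 * a (m + 1) ≤ (e (m + 1) + 2 * a m) + 4 * a (m + 1) := by
            gcongr; exact (min_le_left _ _).trans (this.trans hm)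
        _ = e (m + 1) + 4 * a m := by rw [hai m]; ring
        _ ≤ _ := by gcongr
    · rw [min_eq_right h'] at hm
      rw [hai m, ← add_assoc] at ih
      have : min (a n : ℝ≥0∞)⁻¹ (e n) + 4 * a (m + 1) + 2 * a m ≤
          e (m + 1) + 4 * a n + 2 * a m := ih.trans (by rw [add_right_comm]; gcongr)
      exact (ENNReal.add_le_add_iff_right (by finiteness)).1 this

theorem min_le_add_of_chain' (ha : ∀ n, a n = 2 * a (n + 1))
    (h : ∀ n ≥ k, min (a n : ℝ≥0∞)⁻¹ (e (n + 1)) ≤ e n + 2 * a n) {n m : ℕ} (hn : k ≤ n)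
    (hnm : n ≤ m) : min (a n : ℝ≥0∞)⁻¹ (e m) + 4 * a m ≤ e n + 4 * a n := by
  have hanti : Antitone a := antitone_nat_of_succ_le fun n => by
    rw [ha n]; exact le_mul_of_one_le_left zero_le one_le_two
  have hai : ∀ n, 4 * (a n : ℝ≥0∞) = 4 * a (n + 1) + 2 * a n := fun n => by
    rw [ha n]; push_cast; ring
  induction m, hnm using Nat.le_induction with
  | base => gcongr; exact min_le_right _ _
  | succ m hnm ih =>
    have hm := h m (hn.trans hnm)
    rcases le_total (a n : ℝ≥0∞)⁻¹ (e m) with h' | h'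
    · rw [min_eq_left h'] at ih
      refine le_trans ?_ ih
      gcongr
      · exact min_le_left _ _
      · exact hanti (Nat.le_succ m)
    · rw [min_eq_right h'] at ih
      have : (a n : ℝ≥0∞)⁻¹ ≤ (a m : ℝ≥0∞)⁻¹ := by
        gcongr; exact hanti hnm
      calc min (a n : ℝ≥0∞)⁻¹ (e (m + 1)) + 4 * a (m + 1) ≤ (e m + 2 * a m) + 4 * a (m + 1) := by
            gcongr; exact (min_le_min_right _ this).trans hm
        _ = e m + 4 * a m := by rw [hai m]; ring
        _ ≤ _ := ih

theorem min_le_limsup_add (ha : ∀ n, a n = 2 * a (n + 1))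
    (h : ∀ n ≥ k, min (a n : ℝ≥0∞)⁻¹ (e n) ≤ e (n + 1) + 2 * a n) :
    min (a k : ℝ≥0∞)⁻¹ (e k) ≤ limsup e atTop + 4 * a k := by
  rw [← tsub_le_iff_right]
  refine le_limsup_of_frequently_le (Eventually.frequently ?_) (by isBoundedDefault)
  filter_upwards [eventually_ge_atTop k] with m hm
  rw [tsub_le_iff_right]
  exact le_self_add.trans (min_le_add_of_chain ha h le_rfl hm)

/-- Unless the right-hand side reaches the truncation level, it bounds every `e m` with `m ≥ k`. -/
theorem min_limsup_le_add (ha : ∀ n, a n = 2 * a (n + 1))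
    (h : ∀ n ≥ k, min (a n : ℝ≥0∞)⁻¹ (e (n + 1)) ≤ e n + 2 * a n) :
    min (a k : ℝ≥0∞)⁻¹ (limsup e atTop) ≤ e k + 4 * a k := by
  rcases le_or_gt (a k : ℝ≥0∞)⁻¹ (e k + 4 * a k) with h' | h'
  · exact (min_le_left _ _).trans h'
  refine (min_le_right _ _).trans (limsup_le_of_le (by isBoundedDefault) ?_)
  filter_upwards [eventually_ge_atTop k] with m hm
  have := le_self_add.trans (min_le_add_of_chain' ha h le_rfl hm)
  rcases min_le_iff.1 this with h1 | h1
  · exact absurd h1 h'.not_ge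
  · exact h1

end Sequences

/-! ### The limit space -/

/-- A sequence of finitely supported spaces with summable errors has a limit. -/
theorem RhoClose.exists_limit {F : ℕ → DistMeasSpace.{u}} (hF : ∀ n, (F n).IsFinitary)
    (h : ∀ n, RhoClose ((1 / 2) ^ n) (F n) (F (n + 1))) :
    ∃ X : DistMeasSpace.{u}, ∀ n, RhoClose (40 * (1 / 2) ^ n) (F n) X := by
  let a : ℕ → ℝ≥0 := fun n => (1 / 2) ^ n
  have ha0 : ∀ n, 0 < a n := fun n => by positivity
  have ha : ∀ n, a n = 2 * a (n + 1) := fun n => by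
    simp only [a, pow_succ]
    field_simp
  choose next hnext using fun n => RhoClose.exists_param (ha0 n) (hF n) (hF (n + 1)) (h n)
  let q : ∀ n, (F n).Param := fun n => Nat.rec (hF 0).exists_param.some (fun n φ => next n φ) n
  have hgood : ∀ n, ∃ H : Set ℝ, MeasurableSet H ∧ H ⊆ (q n).dom ∧ H ⊆ (q (n + 1)).dom ∧
      volume (((q n).dom ∪ (q (n + 1)).dom) \ H) ≤ 10 * a n ∧ ∀ s ∈ H, ∀ t ∈ H,
        min (a n : ℝ≥0∞)⁻¹ (edist ((q n).map s) ((q n).map t)) ≤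
          edist ((q (n + 1)).map s) ((q (n + 1)).map t) + 2 * a n ∧
        min (a n : ℝ≥0∞)⁻¹ (edist ((q (n + 1)).map s) ((q (n + 1)).map t)) ≤
          edist ((q n).map s) ((q n).map t) + 2 * a n := fun n => hnext n (q n)
  clear_value q
  choose H hHm hHd hHd' hHv hHe using hgood
  let e : ℝ → ℝ → ℕ → ℝ≥0∞ := fun s t n => edist ((q n).map s) ((q n).map t)
  let D : ℝ → ℝ → ℝ≥0∞ := fun s t => Filter.limsup (e s t) Filter.atTop
  -- The parameters that are good at every step from `k` on.
  let G : ℕ → Set ℝ := fun k => {t | ∀ n ≥ k, t ∈ H n}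
  have hG : ∀ k, MeasurableSet (G k) := fun k => by
    have : G k = ⋂ n, ⋂ (_ : n ≥ k), H n := by ext; simp [G]
    rw [this]
    exact MeasurableSet.iInter fun n => MeasurableSet.iInter fun _ => hHm n
  have hGmono : ∀ {k l}, k ≤ l → G k ⊆ G l := fun hkl t ht n hn => ht n (hkl.trans hn)
  have hD : ∀ k, ∀ s ∈ G k, ∀ t ∈ G k, min (a k : ℝ≥0∞)⁻¹ (e s t k) ≤ D s t + 4 * a k :=
    fun k s hs t ht => min_le_limsup_add ha fun n hn => (hHe n s (hs n hn) t (ht n hn)).1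
  have hD' : ∀ k, ∀ s ∈ G k, ∀ t ∈ G k, min (a k : ℝ≥0∞)⁻¹ (D s t) ≤ e s t k + 4 * a k :=
    fun k s hs t ht => min_limsup_le_add ha fun n hn => (hHe n s (hs n hn) t (ht n hn)).2
  let T : Set ℝ := ⋃ k, G k
  have hT : MeasurableSet T := MeasurableSet.iUnion hG
  let bad : ℕ → Set ℝ := fun k => ⋃ j, ((q (k + j)).dom ∪ (q (k + j + 1)).dom) \ H (k + j)
  have hbad : ∀ k n, k ≤ n → ((q n).dom ∪ (q (n + 1)).dom) \ H n ⊆ bad k := fun k n hkn => by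
    obtain ⟨j, rfl⟩ := Nat.exists_eq_add_of_le hkn
    exact subset_iUnion_of_subset j subset_rfl
  have hbadv : ∀ k, volume (bad k) ≤ (20 * a k : ℝ≥0) := fun k => by
    calc volume (bad k) ≤ ∑' j, volume (((q (k + j)).dom ∪ (q (k + j + 1)).dom) \ H (k + j)) :=
          measure_iUnion_le _
      _ ≤ ∑' j, 10 * (a (k + j) : ℝ≥0∞) := ENNReal.tsum_le_tsum fun j => hHv _
      _ = ∑' j, (10 * a k) * (2 : ℝ≥0∞)⁻¹ ^ j := by
          congr 1 with j
          simp only [a]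
          push_cast
          rw [pow_add, one_div]
          rw [mul_assoc]
      _ = (20 * a k : ℝ≥0) := by
          rw [ENNReal.tsum_mul_left, ENNReal.tsum_geometric, ENNReal.one_sub_inv_two, inv_inv]
          push_cast
          ring
  -- A point of some `G l` is followed down to `k`: it lies in the domain of `q (n + 1)`, so leaving
  -- `H n` would put it in `bad k`. For `hdG` the same is done upwards from `k`.
  have hTG : ∀ k, T \ G k ⊆ bad k := by
    rintro k t ⟨htT, htk⟩
    by_contra hb
    obtain ⟨l, hl⟩ := mem_iUnion.1 htT
    have hdown : ∀ n ≥ k, t ∈ G (n + 1) → t ∈ G n := fun n hn ht m hm => by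
      rcases hm.eq_or_lt with rfl | hm
      · by_contra hH
        exact hb (hbad k n hn ⟨.inr (hHd (n + 1) (ht _ le_rfl)), hH⟩)
      · exact ht m hm
    rcases le_total l k with hlk | hlk
    · exact htk (hGmono hlk hl)
    · exact htk (Nat.decreasingInduction' (P := fun n => t ∈ G n)
        (fun n _ hn ht => hdown n hn ht) hlk hl)
  have hdG : ∀ k, (q k).dom \ G k ⊆ bad k := by
    rintro k t ⟨htd, htk⟩
    by_contra hb
    refine htk fun n hn => ?_
    have : t ∈ (q n).dom ∧ t ∈ H n := by
      induction n, hn using Nat.le_induction with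
      | base => exact ⟨htd, by_contra fun hH => hb (hbad k k le_rfl ⟨.inl htd, hH⟩)⟩
      | succ n hn ih =>
        have h1 := hHd' n ih.2
        exact ⟨h1, by_contra fun hH => hb (hbad k (n + 1) (hn.trans (Nat.le_succ n))
          ⟨.inl h1, hH⟩)⟩
    exact this.2
  have hGd : ∀ k, G k ⊆ (q k).dom := fun k t ht => hHd k (ht k le_rfl)
  have hPfin : IsFiniteMeasure (volume.restrict T) := by
    refine ⟨?_⟩
    rw [Measure.restrict_apply_univ]
    calc volume T ≤ volume ((q 0).dom ∪ bad 0) := measure_mono fun t ht => by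
          by_cases h : t ∈ G 0
          exacts [.inl (hGd 0 h), .inr (hTG 0 ⟨ht, h⟩)]
      _ ≤ volume (q 0).dom + volume (bad 0) := measure_union_le _ _
      _ < ∞ := ENNReal.add_lt_top.2 ⟨by rw [(q 0).volume_dom]; exact measure_lt_top _ _,
          (hbadv 0).trans_lt ENNReal.coe_lt_top⟩
  classical
  -- Outside `T` nothing makes `D` separable, so these parameters, null for the restricted measure,
  -- are collapsed to one.
  let r : ℝ → ℝ := fun t => if t ∈ T then t else 0
  have hr : ∀ t ∈ T, r t = t := fun t ht => if_pos ht
  have hrm : Measurable r := Measurable.ite hT measurable_id measurable_const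
  -- A simple function has finitely many values. Two points of `G k` with the same value are within
  -- `4 * a k` for `D` once this is below the truncation level, whence separability.
  have hreps : ∀ k, ∃ S ⊆ G k, S.Countable ∧ ∀ t ∈ G k, ∃ s ∈ S, (q k).map s = (q k).map t := by
    intro k
    obtain ⟨S, hSG, hS⟩ := exists_subset_bijOn (G k) (q k).map
    refine ⟨S, hSG, ?_, fun t ht => hS.surjOn (mem_image_of_mem _ ht)⟩
    exact (hS.finite_iff_finite.2 ((q k).map.finite_range.subset (image_subset_range _ _))).countable
  choose S hSG hSc hS using hreps
  have he0 : ∀ s t n, (q n).map s = (q n).map t → e s t n = 0 := fun s t n h => by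
    simp only [e, h, edist_self]
  have hD0 : ∀ s, D s s = 0 := fun s => by
    simp only [D, funext fun n => he0 s s n rfl, Filter.limsup_const]
  obtain ⟨X, π, hπm, hπ, hXμ⟩ := DistMeasSpace.exists_of_pseudoDist.{u} (fun s t => D (r s) (r t))
    (volume.restrict T) (fun s => hD0 _)
    (fun s t => by simp only [D, e, edist_comm])
    (fun s t v => ENNReal.limsup_le_limsup_add_limsup fun n => edist_triangle _ _ _)
    (fun s => by
      refine Measurable.limsup fun n => ?_
      exact measurable_edist_right.comp ((q n).map.measurable.comp hrm))
    (S := insert 0 (⋃ k, S k)) ((countable_iUnion hSc).insert 0)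
    (by
      intro t ε hε
      by_cases ht : t ∈ T
      · have hlim : Filter.Tendsto (fun n => 4 * (a n : ℝ≥0∞)) Filter.atTop (nhds 0) := by
          have : Filter.Tendsto a Filter.atTop (nhds 0) :=
            tendsto_pow_atTop_nhds_zero_of_lt_one zero_le (by
              rw [one_div]; exact inv_lt_one_of_one_lt₀ one_lt_two)
          have := (ENNReal.tendsto_coe.2 this)
          simpa using ENNReal.Tendsto.const_mul this (Or.inr (by finiteness : (4 : ℝ≥0∞) ≠ ∞))
        obtain ⟨k, hk⟩ := mem_iUnion.1 ht
        obtain ⟨n, hn1, hn2⟩ := ((hlim.eventually (gt_mem_nhds (lt_min hε one_pos))).and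
          (Filter.eventually_ge_atTop k)).exists
        obtain ⟨s, hs, hst⟩ := hS n t (hGmono hn2 hk)
        refine ⟨s, .inr (mem_iUnion.2 ⟨n, hs⟩), ?_⟩
        rw [hr t ht, hr s (mem_iUnion.2 ⟨n, hSG n hs⟩)]
        have := hD' n s (hSG n hs) t (hGmono hn2 hk)
        rw [he0 s t n hst, zero_add] at this
        rcases min_le_iff.1 this with h1 | h1
        · have h2 : (1 : ℝ≥0∞) ≤ (a n : ℝ≥0∞)⁻¹ := by
            rw [ENNReal.one_le_inv]
            have : a n ≤ 1 := pow_le_one₀ zero_le (by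
              rw [one_div]; exact inv_le_one_of_one_le₀ one_le_two)
            exact_mod_cast this
          exact absurd (h2.trans h1) (hn1.trans_le (min_le_right _ _)).not_ge
        · exact h1.trans_lt (hn1.trans_le (min_le_left _ _))
      · refine ⟨0, .inl rfl, ?_⟩
        have : r 0 = r t := by simp [r, ht]
        rw [this, hD0]
        exact hε)
  have hXT : ∀ A, MeasurableSet A → X.μ A = volume (T ∩ π ⁻¹' A) := fun A hA => by
    rw [hXμ, Measure.map_apply hπm hA, Measure.restrict_apply (hπm hA), inter_comm]
  have hGT : ∀ k, G k ⊆ T := fun k => subset_iUnion G k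
  have hinv : ∀ k, ((20 * a k : ℝ≥0) : ℝ≥0∞)⁻¹ ≤ (a k : ℝ≥0∞)⁻¹ := fun k => by
    gcongr
    exact le_mul_of_one_le_left zero_le (by norm_num)
  have h4 : ∀ k, 4 * (a k : ℝ≥0∞) ≤ 2 * (20 * a k : ℝ≥0) := fun k => by
    push_cast
    rw [← mul_assoc]
    gcongr
    norm_num
  have hle : ∀ k (U V : Set ℝ), U \ G k ⊆ bad k →
      volume (U ∩ V) ≤ volume (G k ∩ V) + (20 * a k : ℝ≥0) := fun k U V hU => by
    calc volume (U ∩ V) ≤ volume ((G k ∩ V) ∪ bad k) := measure_mono fun t ht => by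
          by_cases h : t ∈ G k
          exacts [.inl ⟨h, ht.2⟩, .inr (hU ⟨ht.1, h⟩)]
      _ ≤ volume (G k ∩ V) + volume (bad k) := measure_union_le _ _
      _ ≤ _ := by gcongr; exact hbadv k
  refine ⟨X, fun n => ?_⟩
  have h40 : (40 * (1 / 2) ^ n : ℝ≥0) = 2 * (20 * a n) := by simp only [a]; ring
  rw [h40]
  refine of_coupling volume (mul_pos (by norm_num) (ha0 n)) (G := G n) (φ := (q n).map) (ψ := π)
    (fun s hs t ht => ?_) (fun s hs t ht => ?_) (fun A hA => ?_) (fun A hA => ?_)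
    (fun A hA => ?_) (fun A hA => ?_)
  · rw [hπ, hr s (hGT n hs), hr t (hGT n ht)]
    exact (min_le_min_right _ (hinv n)).trans ((hD n s hs t ht).trans (add_le_add le_rfl (h4 n)))
  · rw [hπ, hr s (hGT n hs), hr t (hGT n ht)]
    exact (min_le_min_right _ (hinv n)).trans ((hD' n s hs t ht).trans (add_le_add le_rfl (h4 n)))
  · rw [← (q n).volume_inter A hA]
    exact hle n _ _ (hdG n)
  · rw [← (q n).volume_inter A hA]
    exact measure_mono (inter_subset_inter_left _ (hGd n))
  · rw [hXT A hA]
    exact hle n _ _ (hTG n)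
  · rw [hXT A hA]
    exact measure_mono (inter_subset_inter_left _ (hGT n))

/-! ### Passage to classes and completeness -/

theorem rhoEquiv_iff {X Y : DistMeasSpace.{u}} :
    RhoEquiv X Y ↔ ∀ a : ℝ≥0, 0 < a → RhoClose a X Y := by
  refine ⟨fun h a ha => RhoClose.of_dRho_lt ?_, fun h => ?_⟩
  · rw [show dRho X Y = 0 from h]
    exact_mod_cast ha
  · refine nonpos_iff_eq_zero.1 (ENNReal.le_of_forall_pos_le_add fun ε hε _ => ?_)
    refine ((h (ε / 3) (by positivity)).dRho_le (by positivity)).trans (le_of_eq ?_)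
    norm_cast
    rw [zero_add, mul_div_cancel₀ _ (by norm_num)]

theorem equivalence_rhoEquiv : Equivalence RhoEquiv.{u} where
  refl X := rhoEquiv_iff.2 fun a ha => RhoClose.refl a ha X
  symm h := rhoEquiv_iff.2 fun a ha => (rhoEquiv_iff.1 h a ha).symm
  trans h₁ h₂ := rhoEquiv_iff.2 fun a ha => by
    have ha' : 0 < a / 4 := by positivity
    have := (rhoEquiv_iff.1 h₁ _ ha').trans ha' (rhoEquiv_iff.1 h₂ _ ha')
    rwa [mul_div_cancel₀ _ (by norm_num)] at this

theorem DMSpace.mk_eq_mk_iff {X Y : DistMeasSpace.{u}} :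
    DMSpace.mk X = DMSpace.mk Y ↔ RhoEquiv X Y :=
  equivalence_rhoEquiv.quot_mk_eq_iff X Y

/-- Closeness of four spaces in a row. -/
theorem RhoClose.trans₃ {a : ℝ≥0} (ha : 0 < a) {X Y Z W : DistMeasSpace.{u}}
    (h₁ : RhoClose a X Y) (h₂ : RhoClose a Y Z) (h₃ : RhoClose a Z W) :
    RhoClose (16 * a) X W := by
  have := (h₁.trans ha h₂).trans (by positivity)
    (h₃.mono (le_mul_of_one_le_left zero_le (by norm_num)))
  rwa [← mul_assoc, show (4 * 4 : ℝ≥0) = 16 by norm_num] at this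

/-- Bridges the Cauchy condition, about some representatives, and convergence, about all of them. -/
theorem RhoClose.congr {a : ℝ≥0} (ha : 0 < a) {X X' Y Y' : DistMeasSpace.{u}}
    (h : RhoClose a X Y) (hX : DMSpace.mk X' = DMSpace.mk X) (hY : DMSpace.mk Y = DMSpace.mk Y') :
    RhoClose (16 * a) X' Y' :=
  trans₃ ha (rhoEquiv_iff.1 (DMSpace.mk_eq_mk_iff.1 hX) a ha) h
    (rhoEquiv_iff.1 (DMSpace.mk_eq_mk_iff.1 hY) a ha)

theorem DMSpace.IsCauchy.exists_rhoClose {X : ℕ → DistMeasSpace.{u}}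
    (h : DMSpace.IsCauchy fun n => DMSpace.mk (X n)) {a : ℝ≥0} (ha : 0 < a) :
    ∃ N, ∀ m ≥ N, ∀ n ≥ N, RhoClose a (X m) (X n) := by
  have ha' : 0 < a / 16 := by positivity
  obtain ⟨N, hN⟩ := h (a / 16 : ℝ≥0) (by exact_mod_cast ha')
  refine ⟨N, fun m hm n hn => ?_⟩
  obtain ⟨X', Y', hX, hY, hd⟩ := hN m hm n hn
  have := (RhoClose.of_dRho_lt hd).congr ha' hX.symm hY
  rwa [mul_div_cancel₀ _ (by norm_num)] at this

theorem DMSpace.IsCauchy.exists_limit {X : ℕ → DistMeasSpace.{u}}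
    (h : DMSpace.IsCauchy fun n => DMSpace.mk (X n)) :
    ∃ Y : DistMeasSpace.{u}, ∀ k : ℕ, ∃ N, ∀ n ≥ N,
      RhoClose (16 * (40 * (1 / 2) ^ k)) (X n) Y := by
  -- The chain `F k`, `X (s k)`, `X (s (k + 1))`, `F (k + 1)` costs the factor 16, leaving the error
  -- `(1 / 2) ^ k`.
  let c : ℕ → ℝ≥0 := fun k => (1 / 2) ^ k / 16
  have hc : ∀ k, 0 < c k := fun k => by positivity
  choose N hN using fun k => h.exists_rhoClose (hc k)
  -- Partial sums make both `s k` and `s (k + 1)` at least `N k`, although `N` need not be monotone.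
  let s : ℕ → ℕ := fun k => ∑ j ∈ Finset.range (k + 1), N j
  have hs : ∀ k, N k ≤ s k := fun k =>
    Finset.single_le_sum (fun _ _ => Nat.zero_le _) (Finset.self_mem_range_succ k)
  have hs' : ∀ k, N k ≤ s (k + 1) := fun k => (hs k).trans (by
    simp only [s]
    rw [Finset.sum_range_succ _ (k + 1)]
    exact Nat.le_add_right _ _)
  choose F hF hXF using fun k => RhoClose.exists_isFinitary (X (s k)) (a := c k / 2)
    (half_pos (hc k))
  have hXF' : ∀ k, RhoClose (c k) (X (s k)) (F k) := fun k => by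
    have := hXF k
    rwa [mul_div_cancel₀ _ two_ne_zero] at this
  have hcc : ∀ k, c (k + 1) ≤ c k := fun k => by
    have : c k = 2 * c (k + 1) := by
      simp only [c, pow_succ]
      field_simp
    rw [this]
    exact le_mul_of_one_le_left zero_le one_le_two
  obtain ⟨Y, hY⟩ := RhoClose.exists_limit hF fun k => by
    have := RhoClose.trans₃ (hc k) (hXF' k).symm (hN k _ (hs k) _ (hs' k))
      ((hXF' (k + 1)).mono (hcc k))
    rwa [mul_div_cancel₀ _ (by norm_num)] at this
  have hcb : ∀ k, c k ≤ 40 * (1 / 2) ^ k := fun k =>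
    (div_le_self zero_le (by norm_num)).trans (le_mul_of_one_le_left zero_le (by norm_num))
  exact ⟨Y, fun k => ⟨N k, fun n hn => RhoClose.trans₃ (by positivity)
    ((hN k n hn _ (hs k)).mono (hcb k)) ((hXF' k).mono (hcb k)) (hY k)⟩⟩

theorem mainTheorem2 :
    Equivalence RhoEquiv.{u} ∧
      ∀ ξ : ℕ → DMSpace.{u}, DMSpace.IsCauchy ξ → ∃ η : DMSpace.{u}, DMSpace.ConvergesTo ξ η := by
  refine ⟨equivalence_rhoEquiv, fun ξ hξ => ?_⟩
  obtain ⟨X, rfl⟩ : ∃ X : ℕ → DistMeasSpace.{u}, ξ = fun n => DMSpace.mk (X n) :=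
    ⟨fun n => (ξ n).out, funext fun n => (Quot.out_eq (ξ n)).symm⟩
  obtain ⟨Y, hY⟩ := hξ.exists_limit
  refine ⟨DMSpace.mk Y, fun ε hε => ?_⟩
  -- The outer 16 pays for the change of representatives, and the 3 below for the return to `dRho`.
  let b : ℕ → ℝ≥0 := fun k => 16 * (16 * (40 * (1 / 2) ^ k))
  have hlim : Filter.Tendsto (fun k => 3 * (b k : ℝ≥0∞)) Filter.atTop (nhds 0) := by
    have h1 : Filter.Tendsto (fun k : ℕ => (1 / 2 : ℝ≥0) ^ k) Filter.atTop (nhds 0) :=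
      tendsto_pow_atTop_nhds_zero_of_lt_one zero_le (by
        rw [one_div]; exact inv_lt_one_of_one_lt₀ one_lt_two)
    have h2 : Filter.Tendsto b Filter.atTop (nhds 0) := by
      have := ((h1.const_mul 40).const_mul 16).const_mul 16
      simp only [mul_zero] at this
      exact this
    simpa using ENNReal.Tendsto.const_mul (ENNReal.tendsto_coe.2 h2)
      (Or.inr (by finiteness : (3 : ℝ≥0∞) ≠ ∞))
  obtain ⟨k, hk⟩ := (hlim.eventually (gt_mem_nhds hε)).exists
  obtain ⟨N, hN⟩ := hY k
  refine ⟨N, fun n hn X' Y' hX' hY' => ?_⟩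
  exact (((hN n hn).congr (by positivity) hX' hY'.symm).dRho_le (by positivity)).trans_lt hk
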